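/- Let $P\subset\mathbb H^3$ be a bounded triangular prism, i.e. a bounded convex polyhedron of the combinatorial type (triangle) $\times$ (segment). A \emph{Coxeter polyhedron} is a convex polyhedron all of whose dihedral angles are of the form $\pi/k$ with $k$ a positive integer. A \emph{Coxeter decomposition} of $P$ is a tiling of $P$ by finitely many Coxeter polyhedra (they cover $P$ and have pairwise disjoint interiors) such that any two distinct tiles that share a two-dimensional piece of a face are symmetric to each other with respect to the plane of that face; the tiles are called the fundamental polyhedra of the decomposition. Then, for every Coxeter decomposition of $P$, every fundamental polyhedron $F$ is either a (bounded) tetrahedron or a (bounded) triangular prism. -/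

import Mathlib

namespace HypPoly

/-- The Lorentzian bilinear form of signature `(3,1)` on `ℝ⁴`. -/
def lor (x y : Fin 4 → ℝ) : ℝ :=
  -(x 0 * y 0) + x 1 * y 1 + x 2 * y 2 + x 3 * y 3

/-- Hyperbolic 3-space: the upper sheet of the two-sheeted hyperboloid (with the topology induced
from `ℝ⁴`, which is the topology of the hyperbolic metric). -/
abbrev H3 : Type := {x : Fin 4 → ℝ // lor x x = -1 ∧ 0 < x 0}

/-- The hyperbolic distance. -/
noncomputable def hdist (x y : H3) : ℝ := Real.arcosh (-lor x.1 y.1)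

/-- A set is bounded if its hyperbolic diameter is finite. -/
def IsBdd (P : Set H3) : Prop := ∃ R : ℝ, ∀ x ∈ P, ∀ y ∈ P, hdist x y ≤ R

/-- The plane of `H3` with unit normal `e` (where `lor e e = 1`). -/
def plane (e : Fin 4 → ℝ) : Set H3 := {x | lor x.1 e = 0}

/-- The closed half-space of `H3` bounded by `plane e`, with outward unit normal `e`. -/
def halfSpace (e : Fin 4 → ℝ) : Set H3 := {x | lor x.1 e ≤ 0}

/-- The reflection of `ℝ⁴` (hence of `H3`) in `plane e`, where `lor e e = 1`. -/
def reflect (e x : Fin 4 → ℝ) : Fin 4 → ℝ := x - (2 * lor x e) • e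

/-- The sets `S` and `T` are symmetric to each other with respect to `plane e`. -/
def SymmetricWrt (e : Fin 4 → ℝ) (S T : Set H3) : Prop :=
  Subtype.val '' T = reflect e '' (Subtype.val '' S)

/-- Dimension of the linear span in `ℝ⁴`. The smallest totally geodesic subspace of `H3` containing
a nonempty set `A` has dimension `spanDim A - 1`: thus `spanDim A = 3` means that `A` lies in a
unique plane, and `spanDim A = 2` means that `A` lies in a unique line. -/
noncomputable def spanDim (A : Set H3) : ℕ :=
  Module.finrank ℝ (Submodule.span ℝ (Subtype.val '' A))

/-- Convex polyhedra: intersections of finitely many half-spaces, with nonempty interior. -/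
def IsPolyhedron (P : Set H3) : Prop :=
  (∃ N : Finset (Fin 4 → ℝ), (∀ e ∈ N, lor e e = 1) ∧ P = ⋂ e ∈ N, halfSpace e) ∧
    (interior P).Nonempty

/-- `e` is the outward unit normal of a (two-dimensional) face of `P`;
the face is `P ∩ plane e`. -/
def IsFaceNormal (P : Set H3) (e : Fin 4 → ℝ) : Prop :=
  lor e e = 1 ∧ P ⊆ halfSpace e ∧ spanDim (P ∩ plane e) = 3

/-- `f` is a two-dimensional face of `P`. -/
def IsFace (P f : Set H3) : Prop := ∃ e, IsFaceNormal P e ∧ f = P ∩ plane e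

/-- `x` is a vertex of `P`: some supporting plane of `P` meets `P` exactly in `x`. -/
def IsVertex (P : Set H3) (x : H3) : Prop :=
  ∃ e, lor e e = 1 ∧ P ⊆ halfSpace e ∧ P ∩ plane e = {x}

/-- The interior dihedral angle between two faces with outward unit normals `e₁` and `e₂`. -/
noncomputable def dihedralAngle (e₁ e₂ : Fin 4 → ℝ) : ℝ := Real.arccos (-lor e₁ e₂)

/-- Coxeter polyhedra: any two distinct faces with a common edge form a dihedral angle `π / k`
for some positive integer `k`. -/
def IsCoxeter (P : Set H3) : Prop :=
  IsPolyhedron P ∧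
    ∀ e₁ e₂, IsFaceNormal P e₁ → IsFaceNormal P e₂ → e₁ ≠ e₂ →
      spanDim (P ∩ plane e₁ ∩ plane e₂) = 2 →
      ∃ k : ℕ, 0 < k ∧ dihedralAngle e₁ e₂ = Real.pi / k

/-- A finite family of Coxeter polyhedra tiling `P` such that any two distinct tiles that share a
two-dimensional piece of a face are symmetric with respect to the plane of that face. -/
structure IsCoxeterDecomposition (P : Set H3) (tiles : Set (Set H3)) : Prop where
  finite : tiles.Finite
  coxeter : ∀ F ∈ tiles, IsCoxeter F
  cover : ⋃₀ tiles = P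
  disjoint_interior : ∀ S ∈ tiles, ∀ T ∈ tiles, S ≠ T → Disjoint (interior S) (interior T)
  symm : ∀ S ∈ tiles, ∀ T ∈ tiles, S ≠ T → ∀ e, IsFaceNormal S e → IsFaceNormal T (-e) →
    spanDim (S ∩ T ∩ plane e) = 3 → SymmetricWrt e S T

/-- The vertices of `P` are indexed by `ι` and its faces by `κ`, with incidence relation `I`.
(For bounded polyhedra the vertex-face incidences determine the combinatorial type.) -/
def HasIncidence (P : Set H3) {ι κ : Type} (I : ι → κ → Prop) : Prop :=
  ∃ (v : ι ≃ {x : H3 // IsVertex P x}) (f : κ ≃ {f : Set H3 // IsFace P f}),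
    ∀ i k, (v i).1 ∈ (f k).1 ↔ I i k

/-- Bounded tetrahedra: four vertices and four faces, the `k`-th face containing all the vertices
but the `k`-th one. -/
def IsBddTetrahedron (P : Set H3) : Prop :=
  IsPolyhedron P ∧ IsBdd P ∧ HasIncidence P (fun i k : Fin 4 => i ≠ k)

/-- Vertex-face incidences of (triangle) × (segment). The vertices are the pairs `(a, b)`; the side
`Sum.inl c` contains the `(a, b)` with `a ≠ c`, the base `Sum.inr d` those with `b = d`. -/
def prismIncidence (i : Fin 3 × Fin 2) : Fin 3 ⊕ Fin 2 → Prop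
  | Sum.inl c => i.1 ≠ c
  | Sum.inr d => i.2 = d

/-- Bounded triangular prisms: bounded polyhedra of the combinatorial type of
(triangle) × (segment). -/
def IsBddTriangularPrism (P : Set H3) : Prop :=
  IsPolyhedron P ∧ IsBdd P ∧ HasIncidence P prismIncidence

end HypPoly

namespace HypPoly
open Filter Topology

/-! ### The Lorentzian form -/

/-! Let `K` be the set of outward unit normals of a tile `F`. Everything rests on the inequality
`card_le`: a tile has at most as many faces as `P`, hence at most five. Boundedness makes the
normals of `F` span `ℝ⁴`, so there are at least four. Four faces give a tetrahedron. For five faces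
the normals satisfy one linear relation up to scale. Their pairwise products are nonpositive
(`lor_nonpos`), which forces every coefficient to be nonzero and the signs to split as three against
two, and this sign pattern is that of a prism.

For the inequality, the normals are replaced by independent vectors: in `K → ℝ`, whose basis vectors
are called simple roots, each normal defines a formal reflection through the Gram matrix of `F`. The
map `comb` from formal vectors to `ℝ⁴` intertwines formal and actual reflections. By `lor_cases`
each off-diagonal Gram entry is `-cos (π / m)` or at most `-1`, so the argument of Tits applies:
every image of a simple root under a word has all its coordinates of one sign. Consequently a word
is determined, as a formal transformation, by the tile that it makes of `F` (`wact_eq_of_image_eq`),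
and a formal root arising from a simple root is determined by its normal in `ℝ⁴`
(`wact_root_eq_of_ract_eq`).

Each face of `P` that carries a face of a tile reached from `F` therefore gives one formal root.
These roots span `K → ℝ`. Indeed, let a functional `u` vanish on them, and choose `c` with positive
coordinates and negative product with every simple root. Among the finitely many elements `w` that
carry `F` to a tile, take one maximizing `u (w c)`. Crossing the `i`-th wall changes this value by a
positive multiple of `u (w αᵢ)`; so `u (w αᵢ) ≤ 0`, with equality by hypothesis if the wall lies in
a face of `P` and cannot be crossed. Expanding `c` in simple roots, the maximum is at most `0`; in
the same way the minimum is at least `0`. So all terms vanish at the maximum, and `u = 0` because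
`w` is invertible. -/

lemma lor_comm (x y : Fin 4 → ℝ) : lor x y = lor y x := by simp only [lor]; ring
lemma lor_add_left (x y z : Fin 4 → ℝ) : lor (x + y) z = lor x z + lor y z := by
  simp only [lor, Pi.add_apply]; ring
lemma lor_smul_left (c : ℝ) (x z : Fin 4 → ℝ) : lor (c • x) z = c * lor x z := by
  simp only [lor, Pi.smul_apply, smul_eq_mul]; ring
lemma lor_sub_left (x y z : Fin 4 → ℝ) : lor (x - y) z = lor x z - lor y z := by
  simp only [lor, Pi.sub_apply]; ring
lemma lor_neg_left (x z : Fin 4 → ℝ) : lor (-x) z = -lor x z := by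
  simp only [lor, Pi.neg_apply]; ring
lemma lor_zero_left (z : Fin 4 → ℝ) : lor 0 z = 0 := by simp [lor]
lemma lor_add_right (x y z : Fin 4 → ℝ) : lor z (x + y) = lor z x + lor z y := by
  simp only [lor, Pi.add_apply]; ring
lemma lor_smul_right (c : ℝ) (x z : Fin 4 → ℝ) : lor z (c • x) = c * lor z x := by
  simp only [lor, Pi.smul_apply, smul_eq_mul]; ring
lemma lor_sub_right (x y z : Fin 4 → ℝ) : lor z (x - y) = lor z x - lor z y := by
  simp only [lor, Pi.sub_apply]; ring
lemma lor_neg_right (x z : Fin 4 → ℝ) : lor z (-x) = -lor z x := by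
  simp only [lor, Pi.neg_apply]; ring
lemma lor_zero_right (z : Fin 4 → ℝ) : lor z 0 = 0 := by simp [lor]

/-- The linear functional `x ↦ lor x e`. -/
def lorL (e : Fin 4 → ℝ) : (Fin 4 → ℝ) →ₗ[ℝ] ℝ where
  toFun x := lor x e
  map_add' x y := lor_add_left x y e
  map_smul' c x := lor_smul_left c x e

@[simp] lemma lorL_apply (e x : Fin 4 → ℝ) : lorL e x = lor x e := rfl

lemma lor_sum_left {ι : Type*} (s : Finset ι) (f : ι → Fin 4 → ℝ) (z : Fin 4 → ℝ) :
    lor (∑ i ∈ s, f i) z = ∑ i ∈ s, lor (f i) z := map_sum (lorL z) f s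

lemma lor_sum_right {ι : Type*} (s : Finset ι) (f : ι → Fin 4 → ℝ) (z : Fin 4 → ℝ) :
    lor z (∑ i ∈ s, f i) = ∑ i ∈ s, lor z (f i) := by
  rw [lor_comm, lor_sum_left]; exact Finset.sum_congr rfl fun i _ => lor_comm _ _

@[fun_prop] lemma continuous_lor {X : Type*} [TopologicalSpace X] {f g : X → Fin 4 → ℝ}
    (hf : Continuous f) (hg : Continuous g) : Continuous fun x => lor (f x) (g x) := by
  unfold lor; fun_prop

lemma exists_lor_eq (f : (Fin 4 → ℝ) →ₗ[ℝ] ℝ) : ∃ y, ∀ x, f x = lor y x := by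
  refine ⟨![-f (Pi.single 0 1), f (Pi.single 1 1), f (Pi.single 2 1), f (Pi.single 3 1)],
    fun x => ?_⟩
  have hx : x = ∑ i, Pi.single i (x i) := (Finset.univ_sum_single x).symm
  conv_lhs => rw [hx]
  have h : ∀ i : Fin 4, f (Pi.single i (x i)) = x i * f (Pi.single i 1) := fun i => by
    rw [← smul_eq_mul, ← map_smul, ← Pi.single_smul, smul_eq_mul, mul_one]
  rw [Fin.sum_univ_four, map_add, map_add, map_add, h, h, h, h]
  simp [lor]
  ring

lemma eq_zero_of_lor_eq_zero {y : Fin 4 → ℝ} (h : ∀ x, lor y x = 0) : y = 0 := by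
  funext i
  have := h (Pi.single i 1)
  fin_cases i <;> simpa [lor, Pi.single_apply] using this

/-! ### The future cone -/

/-- Future-directed timelike vectors. -/
def IsFut (x : Fin 4 → ℝ) : Prop := lor x x < 0 ∧ 0 < x 0

lemma isFut_coe (x : H3) : IsFut x.1 := ⟨by rw [x.2.1]; norm_num, x.2.2⟩

/-- Reversed Cauchy–Schwarz: the ordinary inequality for the spatial parts is beaten strictly by the
time components. Admitting lightlike `y` makes the orthogonal complement of a timelike vector
positive definite. -/
lemma IsFut.lor_neg_of_nonpos {x y : Fin 4 → ℝ} (hx : IsFut x) (hy : lor y y ≤ 0) (hy0 : 0 ≤ y 0)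
    (hne : y ≠ 0) : lor x y < 0 := by
  obtain ⟨h1, h2⟩ := hx
  have hpos : 0 < y 0 := by
    rcases hy0.lt_or_eq with h | h
    · exact h
    · exfalso; apply hne
      unfold lor at hy
      rw [← h] at hy
      have a : y 1 = 0 := by nlinarith [sq_nonneg (y 1), sq_nonneg (y 2), sq_nonneg (y 3)]
      have b : y 2 = 0 := by nlinarith [sq_nonneg (y 1), sq_nonneg (y 2), sq_nonneg (y 3)]
      have c : y 3 = 0 := by nlinarith [sq_nonneg (y 1), sq_nonneg (y 2), sq_nonneg (y 3)]
      funext i; fin_cases i <;> simp [a, b, c, ← h]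
  unfold lor at *
  have hcs : (x 1 * y 1 + x 2 * y 2 + x 3 * y 3) ^ 2 ≤
      (x 1 * x 1 + x 2 * x 2 + x 3 * x 3) * (y 1 * y 1 + y 2 * y 2 + y 3 * y 3) := by
    nlinarith [sq_nonneg (x 1 * y 2 - x 2 * y 1), sq_nonneg (x 1 * y 3 - x 3 * y 1),
      sq_nonneg (x 2 * y 3 - x 3 * y 2)]
  have hlt : (x 1 * x 1 + x 2 * x 2 + x 3 * x 3) * (y 1 * y 1 + y 2 * y 2 + y 3 * y 3) <
      (x 0 * y 0) ^ 2 := by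
    have e1 : x 1 * x 1 + x 2 * x 2 + x 3 * x 3 < x 0 * x 0 := by linarith
    have e2 : y 1 * y 1 + y 2 * y 2 + y 3 * y 3 ≤ y 0 * y 0 := by linarith
    calc _ ≤ (x 1 * x 1 + x 2 * x 2 + x 3 * x 3) * (y 0 * y 0) :=
          mul_le_mul_of_nonneg_left e2 (by
            linarith [mul_self_nonneg (x 1), mul_self_nonneg (x 2), mul_self_nonneg (x 3)])
      _ < (x 0 * x 0) * (y 0 * y 0) := mul_lt_mul_of_pos_right e1 (mul_pos hpos hpos)
      _ = _ := by ring
  have := abs_lt_of_sq_lt_sq (hcs.trans_lt hlt) (mul_pos h2 hpos).le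
  linarith [(abs_lt.1 this).2]

lemma IsFut.ne_zero {x : Fin 4 → ℝ} (hx : IsFut x) : x ≠ 0 := by
  rintro rfl; exact lt_irrefl _ hx.2

lemma IsFut.lor_neg {x y : Fin 4 → ℝ} (hx : IsFut x) (hy : IsFut y) : lor x y < 0 :=
  hx.lor_neg_of_nonpos hy.1.le hy.2.le hy.ne_zero

lemma IsFut.lor_pos_of_perp {x y : Fin 4 → ℝ} (hx : IsFut x) (h : lor x y = 0) (hy : y ≠ 0) :
    0 < lor y y := by
  by_contra! hc
  rcases le_total 0 (y 0) with h0 | h0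
  · exact (hx.lor_neg_of_nonpos hc h0 hy).ne h
  · have := hx.lor_neg_of_nonpos (y := -y) (by simpa [lor_neg_left, lor_neg_right] using hc)
      (by simpa using h0) (neg_ne_zero.2 hy)
    rw [lor_neg_right, h] at this; simp at this

lemma IsFut.isFut_of_neg {x y : Fin 4 → ℝ} (hx : IsFut x) (hy : lor y y < 0) (h : lor x y < 0) :
    IsFut y := by
  refine ⟨hy, ?_⟩
  by_contra! hc
  have hne : y ≠ 0 := by rintro rfl; simp [lor_zero_left] at hy
  have := hx.lor_neg_of_nonpos (y := -y) (by simpa [lor_neg_left, lor_neg_right] using hy.le)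
    (by simpa using hc) (neg_ne_zero.2 hne)
  rw [lor_neg_right] at this; linarith

lemma IsFut.smul {x : Fin 4 → ℝ} (hx : IsFut x) {c : ℝ} (hc : 0 < c) : IsFut (c • x) := by
  refine ⟨?_, mul_pos hc hx.2⟩
  rw [lor_smul_left, lor_smul_right]
  exact mul_neg_of_pos_of_neg hc (mul_neg_of_pos_of_neg hc hx.1)

lemma IsFut.add {x y : Fin 4 → ℝ} (hx : IsFut x) (hy : IsFut y) : IsFut (x + y) := by
  refine ⟨?_, add_pos hx.2 hy.2⟩
  have := hx.lor_neg hy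
  have := hy.lor_neg hx
  simp only [lor_add_left, lor_add_right]
  linarith [hx.1, hy.1]

lemma isOpen_isFut : IsOpen {x | IsFut x} :=
  IsOpen.inter
    (isOpen_lt (by fun_prop : Continuous fun x : Fin 4 → ℝ => lor x x) continuous_const)
    (isOpen_lt continuous_const (by fun_prop : Continuous fun x : Fin 4 → ℝ => x 0))

lemma tendsto_add_smul (q v : Fin 4 → ℝ) : Tendsto (fun t : ℝ => q + t • v) (𝓝[>] 0) (𝓝 q) := by
  have : Continuous fun t : ℝ => q + t • v := by fun_prop
  simpa using (this.tendsto 0).mono_left nhdsWithin_le_nhds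

lemma IsFut.eventually {q : Fin 4 → ℝ} (hq : IsFut q) (v : Fin 4 → ℝ) :
    ∀ᶠ t : ℝ in 𝓝[>] 0, IsFut (q + t • v) :=
  (tendsto_add_smul q v).eventually (isOpen_isFut.mem_nhds hq)

lemma eventually_lor_neg {q e : Fin 4 → ℝ} (hq : lor q e < 0) (v : Fin 4 → ℝ) :
    ∀ᶠ t : ℝ in 𝓝[>] 0, lor (q + t • v) e < 0 :=
  (tendsto_add_smul q v).eventually
    ((isOpen_lt (by fun_prop : Continuous fun x => lor x e) continuous_const).mem_nhds hq)

/-- The point of `H3` on the ray of a future-directed timelike vector. -/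
noncomputable def nrm (w : Fin 4 → ℝ) (hw : IsFut w) : H3 :=
  ⟨(√(-lor w w))⁻¹ • w, by
    have h : 0 < -lor w w := by linarith [hw.1]
    have h2 := Real.mul_self_sqrt h.le
    have h3 := Real.sqrt_pos.2 h
    refine ⟨?_, mul_pos (inv_pos.2 h3) hw.2⟩
    rw [lor_smul_left, lor_smul_right]
    field_simp
    linarith [sq (√(-lor w w))]⟩

lemma inv_sqrt_pos {w : Fin 4 → ℝ} (hw : IsFut w) : 0 < (√(-lor w w))⁻¹ :=
  inv_pos.2 (Real.sqrt_pos.2 (by linarith [hw.1]))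

lemma nrm_mem_halfSpace {w : Fin 4 → ℝ} (hw : IsFut w) {e : Fin 4 → ℝ} :
    nrm w hw ∈ halfSpace e ↔ lor w e ≤ 0 := by
  change lor (_ • w) e ≤ 0 ↔ _
  rw [lor_smul_left]
  exact ⟨fun h => nonpos_of_mul_nonpos_right h (inv_sqrt_pos hw),
    fun h => mul_nonpos_of_nonneg_of_nonpos (inv_sqrt_pos hw).le h⟩

lemma nrm_mem_plane {w : Fin 4 → ℝ} (hw : IsFut w) {e : Fin 4 → ℝ} :
    nrm w hw ∈ plane e ↔ lor w e = 0 := by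
  change lor (_ • w) e = 0 ↔ _
  rw [lor_smul_left, mul_eq_zero, or_iff_right (inv_sqrt_pos hw).ne']

lemma nrm_coe (w : Fin 4 → ℝ) (hw : IsFut w) : (nrm w hw).1 = (√(-lor w w))⁻¹ • w := rfl

lemma eq_smul_nrm (w : Fin 4 → ℝ) (hw : IsFut w) : w = √(-lor w w) • (nrm w hw).1 := by
  rw [nrm_coe, smul_smul, mul_inv_cancel₀, one_smul]
  exact (Real.sqrt_pos.2 (by linarith [hw.1])).ne'

lemma nrm_smul {w : Fin 4 → ℝ} (hw : IsFut w) {x : H3} {c : ℝ} (hc : 0 < c) (h : w = c • x.1) :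
    nrm w hw = x := by
  apply Subtype.ext
  rw [nrm_coe, h, lor_smul_left, lor_smul_right, x.2.1]
  rw [show -(c * (c * -1)) = c * c by ring, Real.sqrt_mul_self hc.le, smul_smul,
    inv_mul_cancel₀ hc.ne', one_smul]

lemma lor_le_neg_one (x y : H3) : lor x.1 y.1 ≤ -1 := by
  by_cases h : x = y
  · rw [h, y.2.1]
  have hx := isFut_coe x
  have hlt := hx.lor_neg (isFut_coe y)
  have hp : lor x.1 (y.1 + lor x.1 y.1 • x.1) = 0 := by
    rw [lor_add_right, lor_smul_right, x.2.1]; ring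
  by_cases h0 : y.1 + lor x.1 y.1 • x.1 = 0
  · exfalso; apply h
    have : y.1 = (-lor x.1 y.1) • x.1 := by rw [neg_smul]; exact eq_neg_of_add_eq_zero_left h0
    rw [← nrm_smul (isFut_coe y) (neg_pos.2 hlt) this]
    exact nrm_smul _ one_pos (one_smul _ _).symm
  · have := hx.lor_pos_of_perp hp h0
    simp only [lor_add_left, lor_add_right, lor_smul_left, lor_smul_right, x.2.1, y.2.1,
      lor_comm y.1 x.1] at this
    nlinarith

/-! ### Interiors -/

/-- An interior point on the plane could be pushed a little along `e` and renormalized, leaving the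
half-space but not `F`. -/
lemma lor_neg_of_mem_interior {F : Set H3} {e : Fin 4 → ℝ} (hF : F ⊆ halfSpace e)
    (he : lor e e = 1) {x : H3} (hx : x ∈ interior F) : lor x.1 e < 0 := by
  refine lt_of_le_of_ne (hF (interior_subset hx)) fun h0 => ?_
  obtain ⟨U, hU, hUF⟩ := isOpen_induced_iff.1 (isOpen_interior (s := F))
  have hxU : x.1 ∈ U := by rw [← hUF] at hx; exact hx
  have hc : ContinuousAt (fun w : Fin 4 → ℝ => (√(-lor w w))⁻¹ • w) x.1 := by
    have : Continuous fun w : Fin 4 → ℝ => √(-lor w w) := by fun_prop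
    refine (this.continuousAt.inv₀ ?_).smul continuousAt_id
    exact (inv_pos.1 (inv_sqrt_pos (isFut_coe x))).ne'
  have h1 : (√(-lor x.1 x.1))⁻¹ • x.1 = x.1 := by rw [x.2.1]; simp
  have h2 : ∀ᶠ t : ℝ in 𝓝[>] 0, (√(-lor (x.1 + t • e) (x.1 + t • e)))⁻¹ • (x.1 + t • e) ∈ U :=
    (hc.tendsto.comp (tendsto_add_smul x.1 e)).eventually
      (by simp only [h1]; exact hU.mem_nhds hxU)
  obtain ⟨t, ⟨ht1, ht2⟩, ht3⟩ :=
    ((h2.and ((isFut_coe x).eventually e)).and self_mem_nhdsWithin).exists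
  have : nrm _ ht2 ∈ interior F := by rw [← hUF]; exact ht1
  have := (nrm_mem_halfSpace ht2).1 (hF (interior_subset this))
  rw [lor_add_left, lor_smul_left, h0, he] at this
  have : 0 < t := ht3
  linarith

lemma mem_interior_of_lor_neg {N : Finset (Fin 4 → ℝ)} {x : H3} (h : ∀ e ∈ N, lor x.1 e < 0) :
    x ∈ interior (⋂ e ∈ N, halfSpace e) := by
  have ho : IsOpen (⋂ e ∈ N, {x : H3 | lor x.1 e < 0}) :=
    isOpen_biInter_finset fun e _ => isOpen_lt (by fun_prop) continuous_const
  refine interior_maximal ?_ ho (by simpa using h)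
  exact Set.iInter₂_mono fun e _ y (hy : lor y.1 e < 0) => hy.le

end HypPoly

namespace HypPoly
open Filter Topology

/-! ### Irredundant systems of half-spaces -/

/-- Redundant constraints are discarded one at a time. If `k` is not redundant, some `x` violates
`k` alone, and the witness `q` is the point where the segment from `x` to `z` meets the plane of
`k`. The convex set `X` is left general in order to treat both the faces of a polyhedron and the
edges of a face. -/
lemma exists_irredundant {X : Set (Fin 4 → ℝ)} (hX : Convex ℝ X) {z : Fin 4 → ℝ} (hz : z ∈ X)
    (K : Finset (Fin 4 → ℝ)) (hzK : ∀ k ∈ K, lor z k < 0) :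
    ∃ K' ⊆ K, (∀ x ∈ X, (∀ k ∈ K', lor x k ≤ 0) → ∀ k ∈ K, lor x k ≤ 0) ∧
      ∀ k ∈ K', ∃ q ∈ X, lor q k = 0 ∧ ∀ l ∈ K', l ≠ k → lor q l < 0 := by
  induction K using Finset.strongInduction with
  | H K ih =>
    by_cases h : ∃ k ∈ K, ∀ x ∈ X, (∀ l ∈ K.erase k, lor x l ≤ 0) → lor x k ≤ 0
    · obtain ⟨k, hk, hx⟩ := h
      obtain ⟨K', hK', h1, h2⟩ := ih _ (Finset.erase_ssubset hk)
        fun l hl => hzK l (Finset.mem_of_mem_erase hl)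
      refine ⟨K', hK'.trans (Finset.erase_subset _ _), fun x hxX hxK l hl => ?_, h2⟩
      by_cases hlk : l = k
      · rw [hlk]; exact hx x hxX (h1 x hxX hxK)
      · exact h1 x hxX hxK l (Finset.mem_erase.2 ⟨hlk, hl⟩)
    · push Not at h
      refine ⟨K, subset_rfl, fun x _ h => h, fun k hk => ?_⟩
      obtain ⟨x, hxX, hxK, hxk⟩ := h k hk
      have hzk := hzK k hk
      have hd : 0 < lor x k - lor z k := by linarith
      refine ⟨(-lor z k / (lor x k - lor z k)) • x + (lor x k / (lor x k - lor z k)) • z,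
        hX hxX hz (by apply div_nonneg <;> linarith) (by apply div_nonneg <;> linarith)
          (by field_simp; ring), ?_, fun l hl hlk => ?_⟩
      · rw [lor_add_left, lor_smul_left, lor_smul_left]; field_simp; ring
      · rw [lor_add_left, lor_smul_left, lor_smul_left]
        have h1 := hxK l (Finset.mem_erase.2 ⟨hlk, hl⟩)
        have h2 := hzK l hl
        have h3 : 0 < lor x k / (lor x k - lor z k) := div_pos hxk hd
        have h4 : 0 < -lor z k / (lor x k - lor z k) := div_pos (by linarith) hd
        nlinarith

lemma convex_isFut : Convex ℝ {x | IsFut x} := by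
  intro x hx y hy a b ha hb hab
  rcases ha.lt_or_eq with ha | rfl
  · rcases hb.lt_or_eq with hb | rfl
    · exact (hx.smul ha).add (hy.smul hb)
    · rw [zero_smul, add_zero]; exact hx.smul ha
  · rw [zero_smul, zero_add]; exact hy.smul (by linarith)

/-! ### Dimensions of faces -/

/-- If `A` contains, up to scale, all small displacements of `q` within `E`, then every direction of
`E` is a difference of two vectors of the span. -/
lemma span_eq_of_eventually {A : Set H3} {E : Submodule ℝ (Fin 4 → ℝ)} (hA : ∀ x ∈ A, x.1 ∈ E)
    {q : Fin 4 → ℝ} (hq : IsFut q)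
    (h : ∀ v ∈ E, ∀ᶠ t : ℝ in 𝓝[>] 0, ∀ hw : IsFut (q + t • v), nrm _ hw ∈ A) :
    Submodule.span ℝ (Subtype.val '' A) = E := by
  apply le_antisymm
  · rw [Submodule.span_le]; rintro _ ⟨x, hx, rfl⟩; exact hA x hx
  have key : ∀ v ∈ E, ∃ t : ℝ, 0 < t ∧ q + t • v ∈ Submodule.span ℝ (Subtype.val '' A) := by
    intro v hv
    obtain ⟨t, ⟨h1, h2⟩, h3⟩ := (((h v hv).and (hq.eventually v)).and self_mem_nhdsWithin).exists
    refine ⟨t, h3, ?_⟩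
    rw [eq_smul_nrm _ h2]
    exact Submodule.smul_mem _ _ (Submodule.subset_span ⟨_, h1 h2, rfl⟩)
  have hq' : q ∈ Submodule.span ℝ (Subtype.val '' A) := by
    obtain ⟨t, -, h⟩ := key 0 E.zero_mem; simpa using h
  intro v hv
  obtain ⟨t, ht, h⟩ := key v hv
  have := Submodule.smul_mem _ t⁻¹ (Submodule.sub_mem _ h hq')
  rwa [add_sub_cancel_left, smul_smul, inv_mul_cancel₀ ht.ne', one_smul] at this

lemma finrank_ker_lorL {e : Fin 4 → ℝ} (he : lor e e = 1) :
    Module.finrank ℝ (LinearMap.ker (lorL e)) = 3 := by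
  have h0 : lorL e ≠ 0 := fun h => by
    have := LinearMap.congr_fun h e; simp [he] at this
  have := Module.Dual.finrank_ker_add_one_of_ne_zero h0
  rw [Module.finrank_fin_fun] at this
  omega

lemma finrank_ker_lorL_inf {e f : Fin 4 → ℝ} (he : lor e e = 1) (hf : lor f f = 1)
    (h : lor e f ^ 2 < 1) :
    Module.finrank ℝ (LinearMap.ker (lorL e) ⊓ LinearMap.ker (lorL f) : Submodule ℝ _) = 2 := by
  rw [← LinearMap.ker_prod]
  have hs : Function.Surjective ((lorL e).prod (lorL f)) := by
    rintro ⟨a, b⟩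
    have hD : 1 - lor e f ^ 2 ≠ 0 := by linarith
    refine ⟨((a - b * lor e f) / (1 - lor e f ^ 2)) • e +
      ((b - a * lor e f) / (1 - lor e f ^ 2)) • f, Prod.ext ?_ ?_⟩
    · change lor _ e = a
      rw [lor_add_left, lor_smul_left, lor_smul_left, he, lor_comm f e]
      field_simp; ring
    · change lor _ f = b
      rw [lor_add_left, lor_smul_left, lor_smul_left, hf]
      field_simp; ring
  have := LinearMap.finrank_range_add_finrank_ker ((lorL e).prod (lorL f))
  rw [LinearMap.range_eq_top.2 hs, finrank_top, Module.finrank_prod, Module.finrank_self,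
    Module.finrank_fin_fun] at this
  omega

/-- Both vectors lie in the positive definite complement of `q`, where Cauchy–Schwarz is strict for
independent vectors. -/
lemma sq_lor_lt_one_of_perp {q e f : Fin 4 → ℝ} (hq : IsFut q) (he : lor e e = 1)
    (hf : lor f f = 1) (hqe : lor q e = 0) (hqf : lor q f = 0) (h1 : e ≠ f) (h2 : e ≠ -f) :
    lor e f ^ 2 < 1 := by
  have hp : lor q (e - lor e f • f) = 0 := by
    rw [lor_sub_right, lor_smul_right, hqe, hqf]; ring
  by_cases h0 : e - lor e f • f = 0
  · exfalso
    have h3 : e = lor e f • f := sub_eq_zero.1 h0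
    have h4 : lor e f * lor e f = 1 := by
      have : lor e e = lor e f * lor e f := by
        conv_lhs => rw [h3]
        rw [lor_smul_left, lor_comm f]
        conv_lhs => rw [← h3]
      rw [← this, he]
    rcases mul_self_eq_one_iff.1 h4 with h5 | h5
    · rw [h5, one_smul] at h3; exact h1 h3
    · rw [h5, neg_one_smul] at h3; exact h2 h3
  · have := hq.lor_pos_of_perp hp h0
    simp only [lor_sub_left, lor_sub_right, lor_smul_left, lor_smul_right, he, hf,
      lor_comm f e] at this
    nlinarith

lemma eq_of_perp_le {e k z : Fin 4 → ℝ} (he : lor e e = 1) (hk : lor k k = 1)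
    (h : ∀ v, lor v e = 0 → lor v k = 0) (hze : lor z e < 0) (hzk : lor z k < 0) : k = e := by
  have h1 : ∀ x, lor x k = lor x e * lor e k := fun x => by
    have := h (x - lor x e • e) (by rw [lor_sub_left, lor_smul_left, he]; ring)
    rw [lor_sub_left, lor_smul_left] at this; linarith
  have h2 : lor e k * lor e k = 1 := by have := h1 k; rw [hk, lor_comm k e] at this; exact this.symm
  have h3 : k - lor e k • e = 0 := eq_zero_of_lor_eq_zero fun x => by
    rw [lor_comm, lor_sub_right, lor_smul_right, h1]; ring
  rcases mul_self_eq_one_iff.1 h2 with h5 | h5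
  · rw [h5, one_smul] at h3; exact sub_eq_zero.1 h3
  · have := h1 z; rw [h5] at this; linarith

lemma span_face {F : Set H3} {e : Fin 4 → ℝ} (h : IsFaceNormal F e) :
    Submodule.span ℝ (Subtype.val '' (F ∩ plane e)) = LinearMap.ker (lorL e) := by
  apply Submodule.eq_of_le_of_finrank_eq
  · rw [Submodule.span_le]; rintro _ ⟨x, hx, rfl⟩; exact hx.2
  · rw [finrank_ker_lorL h.1]; exact h.2.2

lemma nonempty_of_spanDim {A : Set H3} (h : spanDim A ≠ 0) : A.Nonempty := by
  by_contra! hA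
  apply h
  simp [spanDim, hA]

/-! ### Face normals of a polyhedron -/

lemma mem_iff_cone {F : Set H3} {K : Finset (Fin 4 → ℝ)} (hF : F = ⋂ e ∈ K, halfSpace e) {x : H3} :
    x ∈ F ↔ ∀ e ∈ K, lor x.1 e ≤ 0 := by
  subst hF; simp [halfSpace]

lemma nrm_mem_iff {F : Set H3} {K : Finset (Fin 4 → ℝ)} (hF : F = ⋂ e ∈ K, halfSpace e)
    {w : Fin 4 → ℝ} (hw : IsFut w) : nrm w hw ∈ F ↔ ∀ e ∈ K, lor w e ≤ 0 := by
  subst hF; simp [nrm_mem_halfSpace]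

lemma exists_faceNormals {F : Set H3} (hF : IsPolyhedron F) :
    ∃ K : Finset (Fin 4 → ℝ), (∀ e, e ∈ K ↔ IsFaceNormal F e) ∧ F = ⋂ e ∈ K, halfSpace e ∧
      ∀ k ∈ K, ∃ q, IsFut q ∧ lor q k = 0 ∧ ∀ l ∈ K, l ≠ k → lor q l < 0 := by
  obtain ⟨⟨N, hN, hFN⟩, z, hz⟩ := hF
  have hzneg : ∀ e, lor e e = 1 → F ⊆ halfSpace e → lor z.1 e < 0 := fun e h1 h2 =>
    lor_neg_of_mem_interior h2 h1 hz
  have hsub : ∀ e ∈ N, F ⊆ halfSpace e := fun e he x hx => (mem_iff_cone hFN).1 hx e he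
  obtain ⟨K, hKN, h1, h2⟩ := exists_irredundant convex_isFut (isFut_coe z) N
    fun k hk => hzneg k (hN k hk) (hsub k hk)
  have hFK : F = ⋂ e ∈ K, halfSpace e := by
    ext x
    rw [mem_iff_cone hFN, mem_iff_cone rfl]
    exact ⟨fun h e he => h e (hKN he), h1 _ (isFut_coe x)⟩
  refine ⟨K, fun e => ⟨fun he => ⟨hN e (hKN he), hsub e (hKN he), ?_⟩, fun he => ?_⟩, hFK, h2⟩
  · obtain ⟨q, hq, hqe, hql⟩ := h2 e he
    rw [spanDim, span_eq_of_eventually (E := LinearMap.ker (lorL e)) (fun x hx => hx.2) hq,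
      finrank_ker_lorL (hN e (hKN he))]
    intro v hv
    have hve : lor v e = 0 := hv
    have : ∀ᶠ t : ℝ in 𝓝[>] 0, ∀ l ∈ K, l ≠ e → lor (q + t • v) l < 0 := by
      rw [Filter.eventually_all_finset]
      intro l hl
      by_cases hle : l = e
      · simp [hle]
      · exact (eventually_lor_neg (hql l hl hle) v).mono fun t ht _ => ht
    filter_upwards [this] with t ht hw
    refine ⟨(nrm_mem_iff hFK hw).2 fun l hl => ?_, (nrm_mem_plane hw).2 ?_⟩
    · by_cases hle : l = e
      · rw [hle, lor_add_left, lor_smul_left, hqe, hve]; simp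
      · exact (ht l hl hle).le
    · rw [lor_add_left, lor_smul_left, hqe, hve]; simp
  · have hspan := span_face he
    -- If no normal of `K` vanished on the whole face, adding up points of the face, one for each
    -- normal, would give a point of `plane e` interior to `F`.
    have : ∃ k ∈ K, ∀ x ∈ F ∩ plane e, lor x.1 k = 0 := by
      by_contra! hcon
      have hS : ∀ S ⊆ K, ∃ d, IsFut d ∧ lor d e = 0 ∧ (∀ k ∈ K, lor d k ≤ 0) ∧
          ∀ k ∈ S, lor d k < 0 := by
        intro S
        induction S using Finset.induction_on with
        | empty =>
          intro _
          obtain ⟨x, hx⟩ := nonempty_of_spanDim (A := F ∩ plane e) (by rw [he.2.2]; norm_num)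
          exact ⟨x.1, isFut_coe x, hx.2, (mem_iff_cone hFK).1 hx.1, by simp⟩
        | insert k S _ ih =>
          intro hkS
          obtain ⟨d, d1, d2, d3, d4⟩ := ih ((Finset.subset_insert _ _).trans hkS)
          obtain ⟨x, hx, hxk⟩ := hcon k (hkS (Finset.mem_insert_self _ _))
          have hxK := (mem_iff_cone hFK).1 hx.1
          refine ⟨d + x.1, d1.add (isFut_coe x), ?_, fun l hl => ?_, fun l hl => ?_⟩
          · rw [lor_add_left, d2, show lor x.1 e = 0 from hx.2, add_zero]
          · rw [lor_add_left]; linarith [d3 l hl, hxK l hl]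
          · rw [lor_add_left]
            rcases Finset.mem_insert.1 hl with rfl | hl'
            · have := lt_of_le_of_ne (hxK l (hkS hl)) hxk
              linarith [d3 l (hkS hl)]
            · linarith [d4 l hl', hxK l (hkS hl)]
      obtain ⟨d, d1, d2, -, d4⟩ := hS K subset_rfl
      have hint : nrm d d1 ∈ interior F := by
        rw [hFK]
        refine mem_interior_of_lor_neg fun k hk => ?_
        rw [nrm_coe, lor_smul_left]
        exact mul_neg_of_pos_of_neg (inv_sqrt_pos d1) (d4 k hk)
      have := lor_neg_of_mem_interior he.2.1 he.1 hint
      rw [nrm_coe, lor_smul_left, d2, mul_zero] at this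
      exact lt_irrefl _ this
    obtain ⟨k, hk, hke⟩ := this
    have hle : LinearMap.ker (lorL e) ≤ LinearMap.ker (lorL k) := by
      rw [← hspan, Submodule.span_le]
      rintro _ ⟨x, hx, rfl⟩
      exact hke x hx
    have := eq_of_perp_le he.1 (hN k (hKN hk)) (fun v hv => hle hv) (hzneg e he.1 he.2.1)
      (hzneg k (hN k (hKN hk)) (hsub k (hKN hk)))
    rwa [← this]

end HypPoly

/-! ### Face systems and the cone over a bounded polyhedron -/

namespace HypPoly
open Filter Topology

/-- `K` is the set of outward unit normals of the faces of the polyhedron `F`. -/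
structure IsFaceSystem (F : Set H3) (K : Finset (Fin 4 → ℝ)) : Prop where
  mem_iff : ∀ e, e ∈ K ↔ IsFaceNormal F e
  eq_iInter : F = ⋂ e ∈ K, halfSpace e
  relint : ∀ k ∈ K, ∃ q, IsFut q ∧ lor q k = 0 ∧ ∀ l ∈ K, l ≠ k → lor q l < 0
  nonempty : (interior F).Nonempty

lemma IsPolyhedron.exists_faceSystem {F : Set H3} (hF : IsPolyhedron F) :
    ∃ K, IsFaceSystem F K := by
  obtain ⟨K, h1, h2, h3⟩ := exists_faceNormals hF
  exact ⟨K, h1, h2, h3, hF.2⟩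

namespace IsFaceSystem
variable {F : Set H3} {K : Finset (Fin 4 → ℝ)}

lemma unit (h : IsFaceSystem F K) {e : Fin 4 → ℝ} (he : e ∈ K) : lor e e = 1 :=
  ((h.mem_iff e).1 he).1

lemma lor_neg (h : IsFaceSystem F K) {e : Fin 4 → ℝ} (he : e ∈ K) {z : H3} (hz : z ∈ interior F) :
    lor z.1 e < 0 :=
  lor_neg_of_mem_interior ((h.mem_iff e).1 he).2.1 (h.unit he) hz

lemma mem (h : IsFaceSystem F K) {x : H3} : x ∈ F ↔ ∀ e ∈ K, lor x.1 e ≤ 0 :=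
  mem_iff_cone h.eq_iInter

lemma nrm_mem (h : IsFaceSystem F K) {w : Fin 4 → ℝ} (hw : IsFut w) :
    nrm w hw ∈ F ↔ ∀ e ∈ K, lor w e ≤ 0 :=
  nrm_mem_iff h.eq_iInter hw

lemma mem_interior (h : IsFaceSystem F K) {x : H3} (hx : ∀ e ∈ K, lor x.1 e < 0) :
    x ∈ interior F := by
  rw [h.eq_iInter]; exact mem_interior_of_lor_neg hx

lemma ne_neg (h : IsFaceSystem F K) {e f : Fin 4 → ℝ} (he : e ∈ K) (hf : f ∈ K) : e ≠ -f := by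
  rintro rfl
  obtain ⟨z, hz⟩ := h.nonempty
  have h1 := h.lor_neg he hz
  have h2 := h.lor_neg hf hz
  rw [lor_neg_right] at h1
  linarith

/-! ### The cone over a bounded polyhedron -/

/-- The ray `x + t v` reaches the light cone at `t = 1 / √(lor v v)`, so the corresponding points of
`F` escape to infinity. -/
lemma false_of_perp_ray (h : IsFaceSystem F K) (hb : IsBdd F) {x v : Fin 4 → ℝ}
    (hx : ∃ y : H3, y.1 = x ∧ y ∈ F) (hxv : lor x v = 0) (hv : v ≠ 0)
    (hC : ∀ t : ℝ, 0 ≤ t → t ≤ 1 / √(lor v v) → ∀ k ∈ K, lor (x + t • v) k ≤ 0) : False := by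
  obtain ⟨y, rfl, hy⟩ := hx
  obtain ⟨R, hR⟩ := hb
  have hvv : 0 < lor v v := (isFut_coe y).lor_pos_of_perp hxv hv
  have hs := Real.sqrt_pos.2 hvv
  have hM : ∀ p ∈ F, -lor y.1 p.1 ≤ Real.cosh R := by
    intro p hp
    have h1 : 1 ≤ -lor y.1 p.1 := by linarith [lor_le_neg_one y p]
    rw [← Real.cosh_arcosh h1, Real.cosh_le_cosh, abs_of_nonneg (Real.arcosh_nonneg h1)]
    exact (hR y hy p hp).trans (le_abs_self R)
  set M := Real.cosh R
  have hM1 : 1 ≤ M := Real.one_le_cosh R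
  -- Stopping where the norm is `-δ` gives a point with hyperbolic cosine of the distance equal to
  -- `1 / √δ = √(M² + 1)`, which exceeds the bound `M`.
  have hδ : 0 < 1 / (M ^ 2 + 1) := by positivity
  have hδ1 : 1 / (M ^ 2 + 1) < 1 := by rw [div_lt_one (by positivity)]; nlinarith
  set δ := 1 / (M ^ 2 + 1)
  have hMδ : M ^ 2 * δ < 1 := by
    simp only [δ]; rw [mul_one_div, div_lt_one (by positivity)]; linarith
  set t := √(1 - δ) / √(lor v v)
  have ht0 : 0 ≤ t := by positivity
  have ht1 : t ≤ 1 / √(lor v v) := by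
    apply div_le_div_of_nonneg_right _ hs.le
    exact Real.sqrt_le_one.2 (by linarith)
  have htt : t ^ 2 * lor v v = 1 - δ := by
    simp only [t]
    rw [div_pow, Real.sq_sqrt hvv.le, Real.sq_sqrt (by linarith)]
    field_simp
  have hq : lor (y.1 + t • v) (y.1 + t • v) = -δ := by
    simp only [lor_add_left, lor_add_right, lor_smul_left, lor_smul_right, hxv, lor_comm v y.1,
      y.2.1]
    linarith
  have hl : lor y.1 (y.1 + t • v) = -1 := by
    rw [lor_add_right, lor_smul_right, hxv, y.2.1]; ring
  have hfut : IsFut (y.1 + t • v) :=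
    (isFut_coe y).isFut_of_neg (by rw [hq]; linarith) (by rw [hl]; norm_num)
  have := hM _ ((h.nrm_mem hfut).2 (hC t ht0 ht1))
  rw [nrm_coe, lor_smul_right, hl, hq, neg_neg] at this
  have hsδ := Real.sqrt_pos.2 hδ
  have h2 : 1 ≤ M * √δ := by
    rw [mul_neg_one, neg_neg, inv_le_iff_one_le_mul₀ hsδ] at this; exact this
  have h3 : (M * √δ) ^ 2 < 1 := by rw [mul_pow, Real.sq_sqrt hδ.le]; exact hMδ
  nlinarith

/-- Boundedness in linear terms: the polyhedral cone meets the closed complement of the future cone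
only at `0`. A vector of the cone is split into its part along an interior point `z` and a part `v`
orthogonal to `z`; if it were not timelike and future, `v` would provide a ray that stays in `F` up
to the light cone. -/
lemma isFut_of_cone (h : IsFaceSystem F K) (hb : IsBdd F) {w : Fin 4 → ℝ}
    (hw : ∀ k ∈ K, lor w k ≤ 0) (hne : w ≠ 0) : IsFut w := by
  obtain ⟨z, hz⟩ := h.nonempty
  have hzF := interior_subset hz
  have hzK := h.mem.1 hzF
  have hzf := isFut_coe z
  have hperp : ∀ v, lor z.1 v = 0 → (∀ k ∈ K, lor v k ≤ 0) → v = 0 := by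
    intro v hv hvK
    by_contra hv0
    refine h.false_of_perp_ray hb ⟨z, rfl, hzF⟩ hv hv0 fun t ht _ k hk => ?_
    rw [lor_add_left, lor_smul_left]
    nlinarith [hzK k hk, hvK k hk]
  set a := -lor z.1 w with ha
  rcases le_or_gt a 0 with ha0 | ha0
  · exfalso
    have h1 : w - a • z.1 = 0 := by
      refine hperp _ ?_ fun k hk => ?_
      · rw [lor_sub_right, lor_smul_right, z.2.1]; linarith
      · rw [lor_sub_left, lor_smul_left]; nlinarith [hzK k hk, hw k hk]
    have h2 : w = a • z.1 := sub_eq_zero.1 h1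
    have ha1 : a < 0 := lt_of_le_of_ne ha0 fun h0 => hne (by rw [h2, h0, zero_smul])
    have hemp : ∀ k, k ∉ K := fun k hk => by
      have := hw k hk
      rw [h2, lor_smul_left] at this
      nlinarith [h.lor_neg hk hz]
    -- With `K` empty this nonzero vector orthogonal to `z` would be an admissible direction.
    have := hperp ![z.1 1, z.1 0, 0, 0] (by simp [lor]; ring) fun k hk => (hemp k hk).elim
    have h3 := congrFun this 1
    simp at h3
    exact hzf.2.ne' h3
  · set v := a⁻¹ • (w - a • z.1) with hv
    have hw' : w = a • (z.1 + v) := by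
      rw [hv, smul_add, smul_smul, mul_inv_cancel₀ ha0.ne', one_smul]; abel
    have hzv : lor z.1 v = 0 := by
      rw [hv, lor_smul_right, lor_sub_right, lor_smul_right, z.2.1]
      simp [ha]
    rcases lt_or_ge (lor v v) 1 with hv1 | hv1
    · rw [hw']
      refine (hzf.isFut_of_neg ?_ ?_).smul ha0
      · simp only [lor_add_left, lor_add_right, hzv, lor_comm v z.1, z.2.1]; linarith
      · rw [lor_add_right, hzv, z.2.1]; norm_num
    · exfalso
      refine h.false_of_perp_ray hb ⟨z, rfl, hzF⟩ hzv ?_ fun t ht ht1 k hk => ?_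
      · intro h0; rw [h0, lor_zero_left] at hv1; linarith
      · have ht2 : t ≤ 1 := ht1.trans (by
          rw [div_le_one (Real.sqrt_pos.2 (by linarith))]; exact Real.one_le_sqrt.2 hv1)
        have h4 := hw k hk
        rw [hw', lor_smul_left, lor_add_left] at h4
        have h5 : lor z.1 k + lor v k ≤ 0 := nonpos_of_mul_nonpos_right h4 ha0
        rw [lor_add_left, lor_smul_left]
        nlinarith [hzK k hk]

lemma eq_zero_of_perp (h : IsFaceSystem F K) (hb : IsBdd F) {w : Fin 4 → ℝ}
    (hw : ∀ k ∈ K, lor w k = 0) : w = 0 := by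
  by_contra hne
  have h1 := h.isFut_of_cone hb (fun k hk => (hw k hk).le) hne
  have h2 := h.isFut_of_cone hb (w := -w) (fun k hk => by rw [lor_neg_left, hw k hk, neg_zero])
    (neg_ne_zero.2 hne)
  have := h1.2
  have := h2.2
  simp at this
  linarith

lemma span_eq_top (h : IsFaceSystem F K) (hb : IsBdd F) :
    Submodule.span ℝ (K : Set (Fin 4 → ℝ)) = ⊤ := by
  by_contra hne
  obtain ⟨f, hf, hle⟩ := Submodule.exists_le_ker_of_lt_top _ (lt_top_iff_ne_top.2 hne)
  obtain ⟨y, hy⟩ := exists_lor_eq f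
  apply hf
  have : y = 0 := h.eq_zero_of_perp hb fun k hk => by
    rw [← hy]; exact hle (Submodule.subset_span hk)
  ext x
  simp [hy, this, lor_zero_left]

/-- The linear map sending coefficients to the combination of the face normals. -/
noncomputable def comb (K : Finset (Fin 4 → ℝ)) : (K → ℝ) →ₗ[ℝ] (Fin 4 → ℝ) :=
  Fintype.linearCombination ℝ (fun k : K => k.1)

lemma comb_apply (c : K → ℝ) : comb K c = ∑ k, c k • k.1 := by
  simp [comb, Fintype.linearCombination_apply]

lemma comb_surjective (h : IsFaceSystem F K) (hb : IsBdd F) : Function.Surjective (comb K) := by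
  rw [← LinearMap.range_eq_top, comb, Fintype.range_linearCombination]
  simpa using h.span_eq_top hb

/-- An interior point `z` of `F` is itself a positive combination of normals. Otherwise a separating
functional is a nonzero `y` in the cone over `F` with `lor y z ≥ 0`, although both are future
timelike. The vector `c` drives the extremal argument of `functional_eq_zero`. -/
lemma exists_pos_comb (h : IsFaceSystem F K) (hb : IsBdd F) :
    ∃ c : K → ℝ, (∀ k, 0 < c k) ∧ ∀ k ∈ K, lor (comb K c) k < 0 := by
  obtain ⟨z, hz⟩ := h.nonempty
  set Q : Set (K → ℝ) := {c | ∀ k, 0 < c k} with hQ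
  have hQo : IsOpen Q := by
    rw [hQ, Set.ofPred_forall]
    exact isOpen_iInter_of_finite fun k => isOpen_lt continuous_const (continuous_apply k)
  have hQc : Convex ℝ Q := fun c hc d hd a b ha hb hab k =>
    convex_Ioi (0 : ℝ) (hc k) (hd k) ha hb hab
  by_cases hmem : z.1 ∈ comb K '' Q
  · obtain ⟨c, hc, hcz⟩ := hmem
    exact ⟨c, hc, fun k hk => by rw [hcz]; exact h.lor_neg hk hz⟩
  exfalso
  have ho : IsOpen (comb K '' Q) :=
    (LinearMap.isOpenMap_of_finiteDimensional _ (h.comb_surjective hb)) _ hQo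
  obtain ⟨f, hf⟩ := geometric_hahn_banach_open_point (hQc.linear_image _) ho hmem
  obtain ⟨y, hy⟩ := exists_lor_eq f.toLinearMap
  have hf' : ∀ c ∈ Q, lor y (comb K c) < lor y z.1 := fun c hc => by
    have := hf _ ⟨c, hc, rfl⟩
    rwa [← hy, ← hy]
  have h1 : (fun _ => 1 : K → ℝ) ∈ Q := fun k => one_pos
  have hy0 : 0 ≤ lor y z.1 := by
    by_contra! hneg
    have hA := hf' _ h1
    set A := lor y (comb K fun _ => 1)
    have hA' : A < 0 := hA.trans hneg
    have hr : 0 < lor y z.1 / A := div_pos_of_neg_of_neg hneg hA'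
    have := hf' ((lor y z.1 / A) • fun _ => 1) (fun k => by simpa using hr)
    rw [map_smul, lor_smul_right, div_mul_cancel₀ _ hA'.ne] at this
    exact lt_irrefl _ this
  have hyne : y ≠ 0 := by
    rintro rfl
    have := hf' _ h1
    rw [lor_zero_left, lor_zero_left] at this
    exact lt_irrefl _ this
  have hyK : ∀ k ∈ K, lor y k ≤ 0 := by
    intro k hk
    by_contra! hpos
    have hA := hf' _ h1
    set A := lor y (comb K fun _ => 1)
    set s := (lor y z.1 - A) / lor y k with hs
    have hs0 : 0 < s := div_pos (by linarith) hpos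
    classical
    have := hf' ((fun _ => 1) + Pi.single ⟨k, hk⟩ s) fun j => by
      by_cases hj : j = ⟨k, hk⟩
      · subst hj; simp; linarith
      · simp [hj]
    have h2 : comb K (Pi.single ⟨k, hk⟩ s) = s • k := by
      rw [comb_apply, Finset.sum_eq_single ⟨k, hk⟩] <;> simp +contextual
    rw [map_add, lor_add_right, h2, lor_smul_right, hs, div_mul_cancel₀ _ hpos.ne'] at this
    simp only [A] at this
    linarith
  have := (h.isFut_of_cone hb hyK hyne).lor_neg (isFut_coe z)
  linarith

end IsFaceSystem
end HypPoly

namespace HypPoly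
open Filter Topology
namespace IsFaceSystem
variable {F : Set H3} {K : Finset (Fin 4 → ℝ)}

/-! ### Gram matrices of Coxeter polyhedra -/

lemma spanDim_edge (h : IsFaceSystem F K) {e f q : Fin 4 → ℝ} (he : e ∈ K) (hf : f ∈ K)
    (hef : e ≠ f) (hq : IsFut q) (hqe : lor q e = 0) (hqf : lor q f = 0)
    (hcone : ∀ v, lor v e = 0 → lor v f = 0 →
      ∀ᶠ t : ℝ in 𝓝[>] 0, IsFut (q + t • v) → ∀ k ∈ K, lor (q + t • v) k ≤ 0) :
    spanDim (F ∩ plane e ∩ plane f) = 2 := by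
  have hsq := sq_lor_lt_one_of_perp hq (h.unit he) (h.unit hf) hqe hqf hef (h.ne_neg he hf)
  rw [spanDim, span_eq_of_eventually (E := LinearMap.ker (lorL e) ⊓ LinearMap.ker (lorL f)) _ hq,
    finrank_ker_lorL_inf (h.unit he) (h.unit hf) hsq]
  · rintro v ⟨hve, hvf⟩
    change lor v e = 0 at hve
    change lor v f = 0 at hvf
    filter_upwards [hcone v hve hvf] with t ht hw
    refine ⟨⟨(h.nrm_mem hw).2 (ht hw), (nrm_mem_plane hw).2 ?_⟩, (nrm_mem_plane hw).2 ?_⟩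
    · rw [lor_add_left, lor_smul_left, hqe, hve]; simp
    · rw [lor_add_left, lor_smul_left, hqf, hvf]; simp
  · rintro x ⟨⟨-, hxe⟩, hxf⟩
    exact ⟨hxe, hxf⟩

/-- The value `m = 1` is excluded because planes of distinct faces that meet are transversal. -/
lemma exists_angle (h : IsFaceSystem F K) (hc : IsCoxeter F) {e f : Fin 4 → ℝ} (he : e ∈ K)
    (hf : f ∈ K) (hef : e ≠ f) (hadj : spanDim (F ∩ plane e ∩ plane f) = 2) :
    ∃ m : ℕ, 2 ≤ m ∧ lor e f = -Real.cos (Real.pi / m) := by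
  obtain ⟨x, ⟨-, hxe⟩, hxf⟩ := nonempty_of_spanDim (by rw [hadj]; norm_num)
  have hsq := sq_lor_lt_one_of_perp (isFut_coe x) (h.unit he) (h.unit hf) hxe hxf hef
    (h.ne_neg he hf)
  obtain ⟨k, hk0, hk⟩ := hc.2 e f ((h.mem_iff e).1 he) ((h.mem_iff f).1 hf) hef hadj
  have habs := (sq_lt_one_iff_abs_lt_one _).1 hsq
  have hcos : lor e f = -Real.cos (Real.pi / k) := by
    rw [← hk, dihedralAngle, Real.cos_arccos (by linarith [(abs_lt.1 habs).2])
      (by linarith [(abs_lt.1 habs).1]), neg_neg]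
  refine ⟨k, ?_, hcos⟩
  by_contra! hk2
  obtain rfl : k = 1 := by omega
  rw [Nat.cast_one, div_one, Real.cos_pi, neg_neg] at hcos
  rw [hcos] at hsq
  norm_num at hsq

lemma lor_nonpos_of_angle {e f : Fin 4 → ℝ} {m : ℕ} (hm : 2 ≤ m)
    (h : lor e f = -Real.cos (Real.pi / m)) : lor e f ≤ 0 := by
  rw [h, neg_nonpos]
  have h2 : (2 : ℝ) ≤ m := by exact_mod_cast hm
  apply Real.cos_nonneg_of_neg_pi_div_two_le_of_le
  · have : 0 ≤ Real.pi / m := by positivity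
    linarith [Real.pi_pos]
  · exact div_le_div_of_nonneg_left Real.pi_pos.le two_pos h2

/-- Within `plane e` the irredundant constraints are those of the edges of the face, and a point of
the plane outside `F` must violate one of them. -/
lemma exists_adjacent_of_pos (h : IsFaceSystem F K) {e x : Fin 4 → ℝ} (he : e ∈ K)
    (hx : IsFut x) (hxe : lor x e = 0) {l : Fin 4 → ℝ} (hl : l ∈ K) (hxl : 0 < lor x l) :
    ∃ k ∈ K, k ≠ e ∧ spanDim (F ∩ plane e ∩ plane k) = 2 ∧ 0 < lor x k := by
  obtain ⟨z, hz, hze, hzK⟩ := h.relint e he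
  have hconv : Convex ℝ ({x | IsFut x} ∩ (LinearMap.ker (lorL e) : Set (Fin 4 → ℝ))) :=
    convex_isFut.inter (LinearMap.ker (lorL e)).convex
  obtain ⟨K', hK', h1, h2⟩ := exists_irredundant hconv (z := z) ⟨hz, hze⟩ (K.erase e)
    fun k hk => hzK k (Finset.mem_of_mem_erase hk) (Finset.ne_of_mem_erase hk)
  have hle : l ≠ e := by rintro rfl; rw [hxe] at hxl; exact lt_irrefl _ hxl
  obtain ⟨k, hk, hxk⟩ : ∃ k ∈ K', 0 < lor x k := by
    by_contra! hcon
    exact (h1 x ⟨hx, hxe⟩ hcon l (Finset.mem_erase.2 ⟨hle, hl⟩)).not_gt hxl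
  have hkK := Finset.mem_of_mem_erase (hK' hk)
  have hke := Finset.ne_of_mem_erase (hK' hk)
  refine ⟨k, hkK, hke, ?_, hxk⟩
  obtain ⟨q, ⟨hq, hqe⟩, hqk, hql⟩ := h2 k hk
  change lor q e = 0 at hqe
  refine h.spanDim_edge he hkK hke.symm hq hqe hqk fun v hve hvk => ?_
  have hev : ∀ᶠ t : ℝ in 𝓝[>] 0, ∀ j ∈ K', j ≠ k → lor (q + t • v) j < 0 := by
    rw [Filter.eventually_all_finset]
    intro j hj
    by_cases hjk : j = k
    · simp [hjk]
    · exact (eventually_lor_neg (hql j hj hjk) v).mono fun t ht _ => ht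
  filter_upwards [hev] with t ht hfut j hj
  have hte : lor (q + t • v) e = 0 := by rw [lor_add_left, lor_smul_left, hqe, hve]; simp
  by_cases hje : j = e
  · rw [hje, hte]
  · refine h1 _ ⟨hfut, hte⟩ (fun i hi => ?_) j (Finset.mem_erase.2 ⟨hje, hj⟩)
    by_cases hik : i = k
    · rw [hik, lor_add_left, lor_smul_left, hqk, hvk]; simp
    · exact (ht i hi hik).le

/-- Andreev's argument, which needs no adjacency. Project a relative interior point `x` of the face
`f` orthogonally to `plane e`. If `lor e f > 0`, the projection lies beyond `f`, so it violates some
neighbour `k` of `e`. But `lor e k ≤ 0` for a neighbour, so the projection cannot increase the value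
at `k`, which was already nonpositive. -/
lemma lor_nonpos (h : IsFaceSystem F K) (hc : IsCoxeter F) {e f : Fin 4 → ℝ} (he : e ∈ K)
    (hf : f ∈ K) (hef : e ≠ f) : lor e f ≤ 0 := by
  obtain ⟨x, hx, hxf, hxK⟩ := h.relint f hf
  have hxe := hxK e he hef
  have hx'e : lor (x - lor x e • e) e = 0 := by
    rw [lor_sub_left, lor_smul_left, h.unit he]; ring
  have hx' : IsFut (x - lor x e • e) := by
    apply hx.isFut_of_neg
    · rw [lor_sub_right, lor_smul_right, hx'e, lor_sub_left, lor_smul_left, lor_comm e x]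
      nlinarith [hx.1]
    · rw [lor_sub_right, lor_smul_right]
      nlinarith [hx.1]
  by_contra! hpos
  have hx'f : 0 < lor (x - lor x e • e) f := by
    rw [lor_sub_left, lor_smul_left, hxf]
    nlinarith
  obtain ⟨k, hk, hke, hadj, hxk⟩ := h.exists_adjacent_of_pos he hx' hx'e hf hx'f
  obtain ⟨m, hm, hG⟩ := h.exists_angle hc he hk hke.symm hadj
  have hG' := lor_nonpos_of_angle hm hG
  rw [lor_sub_left, lor_smul_left] at hxk
  have : lor x k ≤ 0 := by
    by_cases hkf : k = f
    · rw [hkf, hxf]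
    · exact (hxK k hk hkf).le
  nlinarith

/-- If `-1 < lor e f`, the two planes intersect. Starting inside the face `e` and moving towards `f`
along the component of `f` orthogonal to `e` keeps the other constraints negative, by `lor_nonpos`.
The endpoint is thus on a true edge, where the Coxeter condition applies. -/
lemma lor_cases (h : IsFaceSystem F K) (hc : IsCoxeter F) {e f : Fin 4 → ℝ} (he : e ∈ K)
    (hf : f ∈ K) (hef : e ≠ f) :
    (∃ m : ℕ, 2 ≤ m ∧ lor e f = -Real.cos (Real.pi / m)) ∨ lor e f ≤ -1 := by
  by_cases hG : lor e f ≤ -1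
  · exact Or.inr hG
  left
  push Not at hG
  have hG0 := h.lor_nonpos hc he hf hef
  have hD : 0 < 1 - lor e f ^ 2 := by nlinarith
  obtain ⟨x, hx, hxe, hxK⟩ := h.relint e he
  have hxf := hxK f hf hef.symm
  set g := f - lor e f • e with hg
  -- This length brings `x + s • g` onto `plane f`.
  set s := -lor x f / (1 - lor e f ^ 2) with hs
  have hs0 : 0 < s := div_pos (by linarith) hD
  have hsD : s * (1 - lor e f ^ 2) = -lor x f := div_mul_cancel₀ _ hD.ne'
  have hgk : ∀ k ∈ K, k ≠ e → k ≠ f → lor g k ≤ 0 := by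
    intro k hk hke hkf
    rw [hg, lor_sub_left, lor_smul_left]
    nlinarith [h.lor_nonpos hc he hk hke.symm, h.lor_nonpos hc hf hk hkf.symm]
  have hge : lor g e = 0 := by
    rw [hg, lor_sub_left, lor_smul_left, h.unit he, lor_comm f e]; ring
  have hgf : lor g f = 1 - lor e f ^ 2 := by
    rw [hg, lor_sub_left, lor_smul_left, h.unit hf]; ring
  have hgg : lor g g = 1 - lor e f ^ 2 := by
    change lor g (f - lor e f • e) = _
    rw [lor_sub_right, lor_smul_right, hge, hgf]; ring
  have hxg : lor x g = lor x f := by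
    rw [hg, lor_sub_right, lor_smul_right, hxe]; ring
  have hqe : lor (x + s • g) e = 0 := by rw [lor_add_left, lor_smul_left, hxe, hge]; ring
  have hqf : lor (x + s • g) f = 0 := by rw [lor_add_left, lor_smul_left, hgf, hsD]; ring
  have hq : IsFut (x + s • g) := by
    apply hx.isFut_of_neg
    · simp only [lor_add_left, lor_add_right, lor_smul_left, lor_smul_right, hgg, hsD, hxg,
        lor_comm g x]
      nlinarith [hx.1]
    · rw [lor_add_right, lor_smul_right, hxg]
      nlinarith [hx.1]
  refine h.exists_angle hc he hf hef (h.spanDim_edge he hf hef hq hqe hqf fun v hve hvf => ?_)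
  have hev : ∀ᶠ t : ℝ in 𝓝[>] 0, ∀ j ∈ K, j ≠ e → j ≠ f → lor (x + s • g + t • v) j < 0 := by
    rw [Filter.eventually_all_finset]
    intro j hj
    by_cases hje : j = e
    · simp [hje]
    by_cases hjf : j = f
    · simp [hjf]
    have : lor (x + s • g) j < 0 := by
      rw [lor_add_left, lor_smul_left]
      nlinarith [hxK j hj hje, hgk j hj hje hjf]
    exact (eventually_lor_neg this v).mono fun t ht _ _ => ht
  filter_upwards [hev] with t ht _ j hj
  by_cases hje : j = e
  · rw [hje, lor_add_left, lor_smul_left, hqe, hve]; simp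
  by_cases hjf : j = f
  · rw [hjf, lor_add_left, lor_smul_left, hqf, hvf]; simp
  exact (ht j hj hje hjf).le

end IsFaceSystem
end HypPoly

namespace HypPoly

/-! ### Positivity of roots for a generalized geometric representation of a Coxeter group -/

section AlternatingWords
variable {ι : Type*}

/-- The alternating word in `i` and `j` of length `k` that ends in `j`. -/
def alt : ℕ → ι → ι → List ι
  | 0, _, _ => []
  | k + 1, i, j => alt k j i ++ [j]

@[simp] lemma length_alt (k : ℕ) (i j : ι) : (alt k i j).length = k := by
  induction k generalizing i j with
  | zero => rfl
  | succ k ih => simp [alt, ih]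

lemma exists_alt_add (k m : ℕ) (i j : ι) : ∃ l : List ι, l.length = k ∧
    alt (k + m) i j = l ++ alt m i j := by
  induction m generalizing i j with
  | zero => exact ⟨alt k i j, by simp, by simp [alt]⟩
  | succ m ih =>
    obtain ⟨l, h1, h2⟩ := ih j i
    exact ⟨l, h1, by rw [← add_assoc, alt, h2, alt, List.append_assoc]⟩

lemma alt_succ (k : ℕ) (i j : ι) : alt (k + 1) i j = alt k j i ++ [j] := rfl

end AlternatingWords

section Tits
variable {ι : Type*} [Fintype ι] [DecidableEq ι]

/-- The functional `v ↦ B(v, αᵢ)` for the form with Gram matrix `G`. -/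
def pair (G : ι → ι → ℝ) (i : ι) : (ι → ℝ) →ₗ[ℝ] ℝ where
  toFun v := ∑ j, v j * G j i
  map_add' v w := by simp [add_mul, Finset.sum_add_distrib]
  map_smul' c v := by simp [Finset.mul_sum, mul_assoc]

/-- The simple root `αᵢ`. -/
def root (i : ι) : ι → ℝ := Pi.single i 1

lemma pair_root (G : ι → ι → ℝ) (i j : ι) : pair G i (root j) = G j i := by
  simp [pair, root, Pi.single_apply]

/-- The reflection in the simple root `αᵢ`. -/
def srefl (G : ι → ι → ℝ) (i : ι) : Module.End ℝ (ι → ℝ) :=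
  LinearMap.id - (2 • pair G i).smulRight (root i)

lemma srefl_apply (G : ι → ι → ℝ) (i : ι) (v : ι → ℝ) :
    srefl G i v = v - (2 * pair G i v) • root i := by
  simp [srefl]

/-- The action of a word in the simple reflections. -/
def wact (G : ι → ι → ℝ) (l : List ι) : Module.End ℝ (ι → ℝ) := (l.map (srefl G)).prod

@[simp] lemma wact_nil (G : ι → ι → ℝ) : wact G ([] : List ι) = 1 := rfl
lemma wact_append (G : ι → ι → ℝ) (l m : List ι) : wact G (l ++ m) = wact G l * wact G m := by
  simp [wact]
lemma wact_cons (G : ι → ι → ℝ) (i : ι) (l : List ι) : wact G (i :: l) = srefl G i * wact G l := by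
  simp [wact]
lemma wact_singleton (G : ι → ι → ℝ) (i : ι) : wact G [i] = srefl G i := by
  simp [wact]

/-- A Gram matrix all of whose rank-two minors come from Coxeter relations. -/
structure IsCoxeterGram (G : ι → ι → ℝ) : Prop where
  diag : ∀ i, G i i = 1
  symm : ∀ i j, G i j = G j i
  cases : ∀ i j, i ≠ j → (∃ m : ℕ, 2 ≤ m ∧ G i j = -Real.cos (Real.pi / m)) ∨ G i j ≤ -1

variable {G : ι → ι → ℝ}

lemma IsCoxeterGram.srefl_root (hG : IsCoxeterGram G) (i : ι) :
    srefl G i (root i) = -root i := by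
  rw [srefl_apply, pair_root, hG.diag, mul_one, two_smul]; abel

lemma IsCoxeterGram.srefl_mul_self (hG : IsCoxeterGram G) (i : ι) : srefl G i * srefl G i = 1 := by
  refine LinearMap.ext fun v => ?_
  rw [Module.End.mul_apply, srefl_apply G i v, map_sub, map_smul, hG.srefl_root, srefl_apply,
    Module.End.one_apply, smul_neg]
  abel

lemma IsCoxeterGram.wact_reverse_mul (hG : IsCoxeterGram G) (l : List ι) :
    wact G l.reverse * wact G l = 1 := by
  induction l with
  | nil => simp
  | cons i l ih =>
    rw [List.reverse_cons, wact_append, wact_singleton, wact_cons, mul_assoc,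
      ← mul_assoc (srefl G i), hG.srefl_mul_self, one_mul, ih]

lemma IsCoxeterGram.wact_mul_reverse (hG : IsCoxeterGram G) (l : List ι) :
    wact G l * wact G l.reverse = 1 := by
  simpa using hG.wact_reverse_mul l.reverse

/-- The sequence `U_{k-1}(c)` of values of Chebyshev polynomials. -/
def cheb (c : ℝ) : ℕ → ℝ
  | 0 => 0
  | 1 => 1
  | k + 2 => 2 * c * cheb c (k + 1) - cheb c k

lemma cheb_cos (θ : ℝ) (k : ℕ) : cheb (Real.cos θ) k * Real.sin θ = Real.sin (k * θ) := by
  induction k using Nat.twoStepInduction with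
  | zero => simp [cheb]
  | one => simp [cheb]
  | more k h1 h2 =>
    rw [cheb, sub_mul, h1, mul_assoc, h2]
    push_cast
    rw [show ((k : ℝ) + 2) * θ = (k + 1) * θ + θ by ring,
      show (k : ℝ) * θ = (k + 1) * θ - θ by ring, Real.sin_add, Real.sin_sub]
    ring

lemma cheb_nonneg_of_one_le {c : ℝ} (hc : 1 ≤ c) (k : ℕ) :
    0 ≤ cheb c k ∧ cheb c k ≤ cheb c (k + 1) := by
  induction k with
  | zero => simp [cheb]
  | succ k ih =>
    refine ⟨ih.1.trans ih.2, ?_⟩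
    rw [cheb]
    nlinarith [ih.1.trans ih.2]

lemma sin_pi_div_pos {m : ℕ} (hm : 2 ≤ m) : 0 < Real.sin (Real.pi / m) := by
  have h2 : (2 : ℝ) ≤ m := by exact_mod_cast hm
  apply Real.sin_pos_of_pos_of_lt_pi
  · positivity
  · exact div_lt_self Real.pi_pos (by linarith)

lemma cheb_cos_nonneg {m k : ℕ} (hm : 2 ≤ m) (hk : k ≤ m) :
    0 ≤ cheb (Real.cos (Real.pi / m)) k := by
  have h1 := sin_pi_div_pos hm
  have hm0 : (0 : ℝ) < m := by exact_mod_cast (by omega : 0 < m)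
  refine nonneg_of_mul_nonneg_left ?_ h1
  rw [cheb_cos]
  apply Real.sin_nonneg_of_nonneg_of_le_pi
  · positivity
  · rw [mul_div_assoc', div_le_iff₀ hm0, mul_comm]
    exact mul_le_mul_of_nonneg_left (by exact_mod_cast hk) Real.pi_pos.le

lemma cheb_cos_self {m : ℕ} (hm : 2 ≤ m) : cheb (Real.cos (Real.pi / m)) m = 0 := by
  have h1 := sin_pi_div_pos hm
  have hm0 : (m : ℝ) ≠ 0 := by exact_mod_cast (by omega : m ≠ 0)
  have := cheb_cos (Real.pi / m) m
  rw [mul_div_cancel₀ _ hm0, Real.sin_pi] at this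
  exact (mul_eq_zero.1 this).resolve_right h1.ne'

lemma cheb_cos_pred {m : ℕ} (hm : 2 ≤ m) : cheb (Real.cos (Real.pi / m)) (m - 1) = 1 := by
  have h1 := sin_pi_div_pos hm
  have hm0 : (m : ℝ) ≠ 0 := by exact_mod_cast (by omega : m ≠ 0)
  have := cheb_cos (Real.pi / m) (m - 1)
  rw [Nat.cast_sub (by omega), Nat.cast_one, sub_mul, mul_div_cancel₀ _ hm0, one_mul,
    Real.sin_pi_sub] at this
  exact mul_right_cancel₀ h1.ne' (by rw [this, one_mul])

lemma IsCoxeterGram.wact_alt_root' (hG : IsCoxeterGram G) (k : ℕ) (i j : ι) :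
    wact G (alt (k + 1) j i) (root i) = -wact G (alt k i j) (root i) := by
  rw [alt_succ, wact_append, Module.End.mul_apply, wact_singleton, hG.srefl_root, map_neg]

/-- In rank two the coordinates of the orbit of a simple root obey the Chebyshev recursion at `-G i
j`. Both parities are proved together because the recursion exchanges `i` and `j`. -/
lemma IsCoxeterGram.wact_alt_root (hG : IsCoxeterGram G) (n : ℕ) (i j : ι) :
    (wact G (alt (2 * n) i j) (root i) =
      cheb (-G i j) (2 * n + 1) • root i + cheb (-G i j) (2 * n) • root j) ∧
    wact G (alt (2 * n + 1) i j) (root i) =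
      cheb (-G i j) (2 * n + 1) • root i + cheb (-G i j) (2 * n + 2) • root j := by
  have rec1 : ∀ k i j, wact G (alt (k + 2) i j) (root i) =
      (2 * -G i j) • wact G (alt (k + 1) j i) (root j) - wact G (alt k i j) (root i) := by
    intro k i j
    rw [alt_succ, wact_append, Module.End.mul_apply, wact_singleton, srefl_apply, pair_root,
      map_sub, map_smul, hG.wact_alt_root' k i j]
    module
  induction n generalizing i j with
  | zero =>
    constructor
    · simp [alt, cheb]
    · simp only [alt, List.nil_append, wact_singleton, srefl_apply, pair_root,
        cheb]
      module
  | succ n ih =>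
    have h2 : ∀ c, cheb c (2 * n + 2) = 2 * c * cheb c (2 * n + 1) - cheb c (2 * n) :=
      fun _ => rfl
    have h3 : ∀ c, cheb c (2 * (n + 1) + 1) = 2 * c * cheb c (2 * (n + 1)) - cheb c (2 * n + 1) :=
      fun _ => rfl
    have h4 : ∀ c, cheb c (2 * (n + 1) + 2) =
        2 * c * cheb c (2 * (n + 1) + 1) - cheb c (2 * (n + 1)) := fun _ => rfl
    have e1 : ∀ i j, wact G (alt (2 * (n + 1)) i j) (root i) =
        cheb (-G i j) (2 * (n + 1) + 1) • root i + cheb (-G i j) (2 * (n + 1)) • root j := by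
      intro i j
      rw [h3, show 2 * (n + 1) = 2 * n + 2 by ring, rec1, (ih i j).1, (ih j i).2, hG.symm j i, h2]
      module
    refine ⟨e1 i j, ?_⟩
    rw [h4, show 2 * (n + 1) + 1 = (2 * n + 1) + 2 by ring, rec1, (ih i j).2,
      show 2 * n + 1 + 1 = 2 * (n + 1) by ring, e1, show 2 * n + 1 + 2 = 2 * (n + 1) + 1 by ring,
      hG.symm j i, h3]
    module

end Tits
end HypPoly

/-! ### Braid relation, reduced words and signs of roots -/

namespace HypPoly

section Tits
variable {ι : Type*} [Fintype ι] [DecidableEq ι] {G : ι → ι → ℝ}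

/-- At the angle `π / m` the Chebyshev values with indices `m - 1`, `m`, `m + 1` are `1`, `0`, `-1`,
so both words give `-root i` for even `m` and `-root j` for odd `m`. -/
lemma IsCoxeterGram.wact_alt_root_eq (hG : IsCoxeterGram G) {m : ℕ} (hm : 2 ≤ m) {i j : ι}
    (hij : G i j = -Real.cos (Real.pi / m)) :
    wact G (alt m i j) (root i) = wact G (alt m j i) (root i) := by
  have h0 := cheb_cos_self hm
  have h1 := cheb_cos_pred hm
  have hc : -G i j = Real.cos (Real.pi / m) := by rw [hij, neg_neg]
  have h2 : cheb (Real.cos (Real.pi / m)) (m + 1) = -1 := by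
    obtain ⟨k, rfl⟩ : ∃ k, m = k + 1 := ⟨m - 1, by omega⟩
    rw [cheb, h0]
    rw [Nat.add_sub_cancel] at h1
    rw [h1]; ring
  obtain ⟨k, hk⟩ : ∃ k, m = k + 1 := ⟨m - 1, by omega⟩
  have h3 : wact G (alt m j i) (root i) = -wact G (alt (m - 1) i j) (root i) := by
    rw [hk, hG.wact_alt_root', Nat.add_sub_cancel]
  rcases Nat.even_or_odd' m with ⟨n, hn | hn⟩
  · have a1 := (hG.wact_alt_root n i j).1
    have a2 := (hG.wact_alt_root (n - 1) i j).2
    rw [← hn, hc, h2, h0] at a1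
    rw [show 2 * (n - 1) + 1 = m - 1 by omega, show 2 * (n - 1) + 2 = m by omega, hc, h0, h1] at a2
    rw [h3, a1, a2]
    module
  · have a1 := (hG.wact_alt_root n i j).2
    have a2 := (hG.wact_alt_root n i j).1
    rw [← hn, show 2 * n + 2 = m + 1 by omega, hc, h2, h0] at a1
    rw [← hn, show 2 * n = m - 1 by omega, hc, h0, h1] at a2
    rw [h3, a1, a2]
    module

lemma wact_alt_of_pair_eq_zero (k : ℕ) {i j : ι} {v : ι → ℝ} (hi : pair G i v = 0)
    (hj : pair G j v = 0) : wact G (alt k i j) v = v := by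
  induction k generalizing i j with
  | zero => simp [alt]
  | succ k ih =>
    rw [alt_succ, wact_append, Module.End.mul_apply, wact_singleton, srefl_apply, hj, mul_zero,
      zero_smul, sub_zero, ih hj hi]

/-- The braid relation. -/
lemma IsCoxeterGram.wact_alt_comm (hG : IsCoxeterGram G) {m : ℕ} (hm : 2 ≤ m) {i j : ι}
    (hij : G i j = -Real.cos (Real.pi / m)) :
    wact G (alt m i j) = wact G (alt m j i) := by
  have hs := sin_pi_div_pos hm
  have hD : 0 < 1 - G i j ^ 2 := by
    rw [hij, neg_sq, ← Real.sin_sq]; positivity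
  refine LinearMap.ext fun v => ?_
  -- Since the two-by-two Gram determinant is positive, `v` splits into a combination of the two
  -- roots and a part `w` that both reflections fix.
  set a := (pair G i v - G i j * pair G j v) / (1 - G i j ^ 2) with ha
  set b := (pair G j v - G i j * pair G i v) / (1 - G i j ^ 2) with hb
  set w := v - a • root i - b • root j with hw
  have hwi : pair G i w = 0 := by
    simp only [hw, map_sub, map_smul, pair_root, smul_eq_mul, hG.diag, hG.symm j i, ha, hb]
    field_simp; ring
  have hwj : pair G j w = 0 := by
    simp only [hw, map_sub, map_smul, pair_root, smul_eq_mul, hG.diag, ha, hb]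
    field_simp; ring
  have hv : v = w + a • root i + b • root j := by rw [hw]; abel
  rw [hv, map_add, map_add, map_add, map_add, map_smul, map_smul, map_smul, map_smul,
    wact_alt_of_pair_eq_zero m hwi hwj, wact_alt_of_pair_eq_zero m hwj hwi,
    hG.wact_alt_root_eq hm hij, hG.wact_alt_root_eq hm (hG.symm j i ▸ hij)]

/-- The word `l` has minimal length among the words with the same action. -/
def IsReduced (G : ι → ι → ℝ) (l : List ι) : Prop :=
  ∀ l', wact G l' = wact G l → l.length ≤ l'.length

/-- Appending `i` does not give an element with a shorter word. -/
def NoDescent (G : ι → ι → ℝ) (l : List ι) (i : ι) : Prop :=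
  ∀ l', wact G l' = wact G (l ++ [i]) → l.length ≤ l'.length

lemma IsReduced.of_append {l m : List ι} (h : IsReduced G (l ++ m)) :
    IsReduced G l ∧ IsReduced G m := by
  constructor
  · intro l' hl'
    have := h (l' ++ m) (by rw [wact_append, wact_append, hl'])
    simpa using this
  · intro m' hm'
    have := h (l ++ m') (by rw [wact_append, wact_append, hm'])
    simpa using this

lemma IsCoxeterGram.not_noDescent_concat (hG : IsCoxeterGram G) (l : List ι) (i : ι) :
    ¬ NoDescent G (l ++ [i]) i := by
  intro h
  have := h l (by
    rw [wact_append, wact_append, wact_singleton, mul_assoc, hG.srefl_mul_self, mul_one])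
  simp at this

/-- The last letter cannot be `i`, so it is `j`; by reducedness the rest has no descent at `j`, and
the roles alternate. -/
lemma IsCoxeterGram.eq_alt (hG : IsCoxeterGram G) (u : List ι) {i j : ι}
    (hu : ∀ x ∈ u, x = i ∨ x = j) (hr : IsReduced G u) (hd : NoDescent G u i) :
    u = alt u.length i j := by
  induction u using List.reverseRecOn generalizing i j with
  | nil => rfl
  | append_singleton u x ih =>
    have hx : x = j := by
      rcases hu x (by simp) with rfl | h
      · exact (hG.not_noDescent_concat u x hd).elim
      · exact h
    subst hx
    rw [List.length_append, List.length_singleton, alt_succ]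
    congr 1
    refine ih (fun y hy => (hu y (by simp [hy])).symm) hr.of_append.1 fun l' hl' => ?_
    have := hr l' hl'
    rw [List.length_append] at this
    omega

lemma IsCoxeterGram.dihedral_nonneg (hG : IsCoxeterGram G) {u : List ι} {i j : ι} (hij : i ≠ j)
    (hu : ∀ x ∈ u, x = i ∨ x = j) (hr : IsReduced G u) (hd : NoDescent G u i) :
    ∃ a b : ℝ, 0 ≤ a ∧ 0 ≤ b ∧ wact G u (root i) = a • root i + b • root j := by
  have halt := hG.eq_alt u hu hr hd
  have hpos : ∀ k ≤ u.length + 1, 0 ≤ cheb (-G i j) k := by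
    intro k hk
    rcases hG.cases i j hij with ⟨m, hm, h⟩ | h
    -- Otherwise `u` ends in an alternating word of length `m`, which the braid relation rewrites to
    -- end in `i`, contradicting the absence of a descent.
    · have hlt : u.length < m := by
        by_contra! hle
        obtain ⟨p, hp, hpe⟩ := exists_alt_add (u.length - m) m i j
        rw [Nat.sub_add_cancel hle, ← halt] at hpe
        obtain ⟨n, rfl⟩ : ∃ n, m = n + 1 := ⟨m - 1, by omega⟩
        have := hd (p ++ alt n i j) (by
          rw [hpe, wact_append, wact_append, wact_append, hG.wact_alt_comm hm h, alt_succ,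
            wact_append, wact_singleton, mul_assoc, mul_assoc, hG.srefl_mul_self, mul_one])
        rw [List.length_append, hp, length_alt] at this
        omega
      rw [h, neg_neg]
      exact cheb_cos_nonneg hm (by omega)
    · exact (cheb_nonneg_of_one_le (by linarith) k).1
  rcases Nat.even_or_odd' u.length with ⟨n, hn | hn⟩
  · refine ⟨_, _, hpos (2 * n + 1) (by omega), hpos (2 * n) (by omega), ?_⟩
    rw [halt, hn]; exact (hG.wact_alt_root n i j).1
  · refine ⟨_, _, hpos (2 * n + 1) (by omega), hpos (2 * n + 2) (by omega), ?_⟩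
    rw [halt, hn]; exact (hG.wact_alt_root n i j).2

/-- Induction on length, where length is measured in the linear group. With `j` the last letter of
`l`, write `l` without loss of length as `v ++ u`, with `u` a word in `i` and `j` and `v` as short
as possible. Then `v` has no descent at `i` or `j`, so the induction applies to it, while `u` sends
`root i` to a nonnegative combination of the two roots. -/
lemma IsCoxeterGram.wact_root_nonneg_of_reduced (hG : IsCoxeterGram G) (n : ℕ) :
    ∀ (l : List ι) (i : ι), l.length = n → IsReduced G l → NoDescent G l i →
      0 ≤ wact G l (root i) := by
  induction n using Nat.strong_induction_on with
  | _ n ih =>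
  intro l i hn hr hd
  rcases List.eq_nil_or_concat l with rfl | ⟨l₀, j, hl⟩
  · intro k
    rw [wact_nil, Module.End.one_apply, root, Pi.single_apply]
    simp only [Pi.zero_apply]
    split_ifs <;> norm_num
  rw [List.concat_eq_append] at hl
  have hij : i ≠ j := by
    rintro rfl
    rw [hl] at hd
    exact hG.not_noDescent_concat _ _ hd
  have hex : ∃ k, ∃ v u : List ι, v.length = k ∧ (∀ x ∈ u, x = i ∨ x = j) ∧
      wact G (v ++ u) = wact G l ∧ (v ++ u).length = l.length :=
    ⟨_, l₀, [j], rfl, by simp, by rw [hl], by rw [hl]⟩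
  classical
  obtain ⟨v, u, hvk, hu, hvu, hlen⟩ := Nat.find_spec hex
  have hmin := fun k => Nat.find_min' hex (m := k)
  have hvlt : v.length < n := by
    have := hmin _ ⟨l₀, [j], rfl, by simp, by rw [hl], by rw [hl]⟩
    rw [hl, List.length_append, List.length_singleton] at hn
    omega
  have hvur : IsReduced G (v ++ u) := fun l' hl' => hlen ▸ hr l' (hl'.trans hvu)
  have hvd : ∀ s, s = i ∨ s = j → NoDescent G v s := by
    intro s hs v' hv'
    by_contra! hlt
    have e1 : wact G (v' ++ s :: u) = wact G l := by
      rw [← hvu, wact_append, hv', wact_append, wact_singleton, wact_cons, wact_append, mul_assoc,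
        ← mul_assoc (srefl G s), hG.srefl_mul_self, one_mul]
    have e2 := hr _ e1
    rw [List.length_append] at hlen
    rw [List.length_append, List.length_cons] at e2
    have := hmin _ ⟨v', s :: u, rfl, by simpa using ⟨hs, hu⟩, e1, by
      rw [List.length_append, List.length_cons]; omega⟩
    omega
  have hud : NoDescent G u i := fun u' hu' => by
    have := hd (v ++ u') (by
      rw [wact_append, hu', wact_append, wact_append, ← hvu, wact_append, mul_assoc])
    rw [List.length_append] at this hlen
    omega
  obtain ⟨a, b, ha, hb, hab⟩ := hG.dihedral_nonneg hij hu hvur.of_append.2 hud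
  rw [← hvu, wact_append, Module.End.mul_apply, hab, map_add, map_smul, map_smul]
  exact add_nonneg (smul_nonneg ha (ih _ hvlt v i rfl hvur.of_append.1 (hvd i (Or.inl rfl))))
    (smul_nonneg hb (ih _ hvlt v j rfl hvur.of_append.1 (hvd j (Or.inr rfl))))

lemma exists_reduced (G : ι → ι → ℝ) (l : List ι) : ∃ l', wact G l' = wact G l ∧ IsReduced G l' := by
  classical
  have hex : ∃ n, ∃ l' : List ι, l'.length = n ∧ wact G l' = wact G l := ⟨_, l, rfl, rfl⟩
  obtain ⟨l', h1, h2⟩ := Nat.find_spec hex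
  exact ⟨l', h2, fun l'' h => h1 ▸ Nat.find_min' hex ⟨l'', rfl, h.trans h2⟩⟩

lemma IsCoxeterGram.wact_root_nonpos_of_concat (hG : IsCoxeterGram G) {l : List ι} {i : ι}
    (hr : IsReduced G (l ++ [i])) : wact G (l ++ [i]) (root i) ≤ 0 := by
  have := hG.wact_root_nonneg_of_reduced _ l i rfl hr.of_append.1 fun l' hl' => by
    have := hr l' hl'
    rw [List.length_append] at this
    omega
  rw [wact_append, Module.End.mul_apply, wact_singleton, hG.srefl_root, map_neg]
  simpa using this

/-- Every root is a nonnegative or a nonpositive combination of simple roots. -/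
lemma IsCoxeterGram.wact_root_sign (hG : IsCoxeterGram G) (l : List ι) (i : ι) :
    0 ≤ wact G l (root i) ∨ wact G l (root i) ≤ 0 := by
  obtain ⟨l₁, h1, hr⟩ := exists_reduced G l
  rw [← h1]
  by_cases hd : NoDescent G l₁ i
  · exact Or.inl (hG.wact_root_nonneg_of_reduced _ l₁ i rfl hr hd)
  right
  unfold NoDescent at hd
  push Not at hd
  obtain ⟨l₂, h2, hlt⟩ := hd
  have h3 : wact G (l₂ ++ [i]) = wact G l₁ := by
    rw [wact_append, h2, wact_append, wact_singleton, mul_assoc, hG.srefl_mul_self, mul_one]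
  rw [← h3]
  apply hG.wact_root_nonpos_of_concat
  intro l' hl'
  have := hr l' (hl'.trans h3)
  rw [List.length_append, List.length_singleton]
  omega

/-- A nontrivial element makes some simple root negative. -/
lemma IsCoxeterGram.exists_wact_root_nonpos (hG : IsCoxeterGram G) {l : List ι}
    (hl : wact G l ≠ 1) : ∃ i, wact G l (root i) ≤ 0 := by
  obtain ⟨l₁, h1, hr⟩ := exists_reduced G l
  rcases List.eq_nil_or_concat l₁ with rfl | ⟨l₀, j, hl₀⟩
  · exact (hl (by rw [← h1, wact_nil])).elim
  rw [List.concat_eq_append] at hl₀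
  subst hl₀
  exact ⟨j, by rw [← h1]; exact hG.wact_root_nonpos_of_concat hr⟩

end Tits
end HypPoly

/-! ### From formal roots to reflections of hyperbolic space -/

namespace HypPoly
open Filter Topology

/-- The reflection in `plane e` as a linear map. -/
def reflL (e : Fin 4 → ℝ) : Module.End ℝ (Fin 4 → ℝ) :=
  LinearMap.id - (2 • lorL e).smulRight e

lemma reflL_apply (e x : Fin 4 → ℝ) : reflL e x = reflect e x := by
  simp [reflL, reflect]

lemma lor_reflL {e : Fin 4 → ℝ} (he : lor e e = 1) (x y : Fin 4 → ℝ) :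
    lor (reflL e x) (reflL e y) = lor x y := by
  simp only [reflL_apply, reflect, lor_sub_left, lor_sub_right, lor_smul_left, lor_smul_right, he,
    lor_comm e y]
  ring

namespace IsFaceSystem
variable {F : Set H3} {K : Finset (Fin 4 → ℝ)}

/-- The Gram matrix of a finite set of normals. -/
def gram (K : Finset (Fin 4 → ℝ)) (i j : K) : ℝ := lor i.1 j.1

/-- The action on `ℝ⁴` of a word in the reflections in the faces. -/
def ract (l : List K) : Module.End ℝ (Fin 4 → ℝ) := (l.map fun k => reflL k.1).prod

lemma ract_append (l m : List K) : ract (l ++ m) = ract l * ract m := by simp [ract]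
lemma ract_cons (i : K) (l : List K) : ract (i :: l) = reflL i.1 * ract l := by simp [ract]
lemma ract_singleton (i : K) : ract [i] = reflL i.1 := by simp [ract]

lemma isCoxeterGram (h : IsFaceSystem F K) (hc : IsCoxeter F) : IsCoxeterGram (gram K) where
  diag i := h.unit i.2
  symm _ _ := lor_comm _ _
  cases i j hij := h.lor_cases hc i.2 j.2 (Subtype.coe_injective.ne hij)

lemma lor_comb (v : K → ℝ) (x : Fin 4 → ℝ) : lor (comb K v) x = ∑ j, v j * lor j.1 x := by
  simp [comb_apply, lor_sum_left, lor_smul_left]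

lemma comb_root [DecidableEq K] (i : K) : comb K (root i) = i.1 := by
  rw [comb_apply, Finset.sum_eq_single i] <;> simp +contextual [root]

lemma lor_comb_eq_pair (i : K) (v : K → ℝ) : lor (comb K v) i.1 = pair (gram K) i v :=
  lor_comb v i.1

lemma comb_wact [DecidableEq K] (l : List K) (v : K → ℝ) :
    comb K (wact (gram K) l v) = ract l (comb K v) := by
  induction l with
  | nil => rfl
  | cons i l ih =>
    rw [wact_cons, ract_cons, Module.End.mul_apply, Module.End.mul_apply, srefl_apply, map_sub,
      map_smul, comb_root, ← lor_comb_eq_pair, ih, reflL_apply, reflect]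

lemma lor_ract (h : IsFaceSystem F K) (l : List K) (x y : Fin 4 → ℝ) :
    lor (ract l x) (ract l y) = lor x y := by
  induction l with
  | nil => rfl
  | cons i l ih =>
    rw [ract_cons, Module.End.mul_apply, Module.End.mul_apply, lor_reflL (h.unit i.2), ih]

lemma ract_reverse_mul [DecidableEq K] (h : IsFaceSystem F K) (hc : IsCoxeter F) (hb : IsBdd F)
    (l : List K) : ract l.reverse * ract l = 1 := by
  refine LinearMap.ext fun x => ?_
  obtain ⟨v, rfl⟩ := h.comb_surjective hb x
  rw [← ract_append, ← comb_wact, wact_append, (h.isCoxeterGram hc).wact_reverse_mul]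
  rfl

/-- Distinct simple roots have distinct images, equivariantly. -/
lemma wact_root_eq [DecidableEq K] (h : IsFaceSystem F K) (hc : IsCoxeter F) {l : List K} {i j : K}
    (hij : ract l i.1 = j.1) : wact (gram K) l (root i) = root j := by
  set v := wact (gram K) l (root i) with hv
  have hcomb : comb K v = j.1 := by rw [hv, comb_wact, comb_root, hij]
  -- If `v` is nonnegative, pairing with a relative interior point of the face `j` kills every
  -- coordinate except `v j`. If `v` is nonpositive, an interior point of `F` lies on the wrong side
  -- of the normal `j`.
  rcases (h.isCoxeterGram hc).wact_root_sign l i with hs | hs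
  · obtain ⟨q, -, hqj, hqK⟩ := h.relint j.1 j.2
    have h1 : ∑ k, v k * lor k.1 q = 0 := by rw [← lor_comb, hcomb, lor_comm, hqj]
    have h2 : ∀ k ∈ Finset.univ, v k * lor k.1 q = 0 := by
      apply (Finset.sum_eq_zero_iff_of_nonpos _).1 h1
      intro k _
      refine mul_nonpos_of_nonneg_of_nonpos (hs k) ?_
      rw [lor_comm]
      by_cases hkj : k = j
      · rw [hkj, hqj]
      · exact (hqK k.1 k.2 (Subtype.coe_injective.ne hkj)).le
    have h3 : v = v j • root j := by
      funext k
      by_cases hkj : k = j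
      · simp [hkj, root]
      · have := (mul_eq_zero.1 (h2 k (Finset.mem_univ k))).resolve_right (by
          rw [lor_comm]; exact (hqK k.1 k.2 (Subtype.coe_injective.ne hkj)).ne)
        simp [this, root, hkj]
    have h4 : v j = 1 := by
      have : lor (comb K v) j.1 = 1 := by rw [hcomb, h.unit j.2]
      rwa [h3, map_smul, comb_root, lor_smul_left, h.unit j.2, mul_one] at this
    rw [h3, h4, one_smul]
  · exfalso
    obtain ⟨z, hz⟩ := h.nonempty
    have h1 : ∑ k, v k * lor k.1 z.1 < 0 := by
      rw [← lor_comb, hcomb, lor_comm]; exact h.lor_neg j.2 hz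
    have h2 : 0 ≤ ∑ k, v k * lor k.1 z.1 := Finset.sum_nonneg fun k _ =>
      mul_nonneg_of_nonpos_of_nonpos (hs k) (by rw [lor_comm]; exact (h.lor_neg k.2 hz).le)
    linarith

/-- A nontrivial formal element makes some simple root nonpositive, so its normal has nonnegative
product with an interior point `z` of `F`. As `z` also lies in the image of `F`, that product is
nonpositive. Hence it vanishes and so does the root, although its image is a unit vector. -/
lemma wact_eq_one [DecidableEq K] (h : IsFaceSystem F K) (hc : IsCoxeter F) {l : List K}
    (hl : ract l '' (Subtype.val '' F) = Subtype.val '' F) : wact (gram K) l = 1 := by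
  by_contra hne
  obtain ⟨i, hi⟩ := (h.isCoxeterGram hc).exists_wact_root_nonpos hne
  set v := wact (gram K) l (root i) with hv
  have hcomb : comb K v = ract l i.1 := by rw [hv, comb_wact, comb_root]
  obtain ⟨z, hz⟩ := h.nonempty
  obtain ⟨_, ⟨y, hy, rfl⟩, hyz⟩ : z.1 ∈ ract l '' (Subtype.val '' F) := by
    rw [hl]; exact ⟨z, interior_subset hz, rfl⟩
  have h1 : ∑ k, v k * lor k.1 z.1 ≤ 0 := by
    rw [← lor_comb, hcomb, ← hyz, h.lor_ract, lor_comm]; exact h.mem.1 hy i.1 i.2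
  have h0 : ∀ k ∈ Finset.univ, 0 ≤ v k * lor k.1 z.1 := fun k _ =>
      mul_nonneg_of_nonpos_of_nonpos (hi k) (by rw [lor_comm]; exact (h.lor_neg k.2 hz).le)
  have h2 := (Finset.sum_eq_zero_iff_of_nonneg h0).1 (le_antisymm h1 (Finset.sum_nonneg h0))
  have hv0 : v = 0 := by
    funext k
    refine (mul_eq_zero.1 (h2 k (Finset.mem_univ k))).resolve_right ?_
    rw [lor_comm]; exact (h.lor_neg k.2 hz).ne
  have : lor (comb K v) (comb K v) = 1 := by rw [hcomb, h.lor_ract, h.unit i.2]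
  rw [hv0, map_zero, lor_zero_left] at this
  norm_num at this

lemma wact_eq_of_image_eq [DecidableEq K] (h : IsFaceSystem F K) (hc : IsCoxeter F) (hb : IsBdd F)
    {l m : List K} (hlm : ract l '' (Subtype.val '' F) = ract m '' (Subtype.val '' F)) :
    wact (gram K) l = wact (gram K) m := by
  have h1 : ract (l.reverse ++ m) '' (Subtype.val '' F) = Subtype.val '' F := by
    have e1 : ∀ x, ract l.reverse (ract l x) = x := fun x =>
      LinearMap.congr_fun (h.ract_reverse_mul hc hb l) x
    have e2 : ∀ x, ract (l.reverse ++ m) x = ract l.reverse (ract m x) := fun x => by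
      rw [ract_append, Module.End.mul_apply]
    rw [show (⇑(ract (l.reverse ++ m)) : (Fin 4 → ℝ) → _) = ract l.reverse ∘ ract m from
      funext e2, Set.image_comp, ← hlm, ← Set.image_comp]
    convert Set.image_id _
    exact funext e1
  have h2 := h.wact_eq_one hc h1
  rw [wact_append] at h2
  calc wact (gram K) l = wact (gram K) l * (wact (gram K) l.reverse * wact (gram K) m) := by
        rw [h2, mul_one]
    _ = wact (gram K) m := by
        rw [← mul_assoc, (h.isCoxeterGram hc).wact_mul_reverse, one_mul]

lemma wact_root_eq_of_ract_eq [DecidableEq K] (h : IsFaceSystem F K) (hc : IsCoxeter F)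
    (hb : IsBdd F) {l m : List K} {i j : K} (hij : ract l i.1 = ract m j.1) :
    wact (gram K) l (root i) = wact (gram K) m (root j) := by
  have h1 : ract (m.reverse ++ l) i.1 = j.1 := by
    rw [ract_append, Module.End.mul_apply, hij]
    exact LinearMap.congr_fun (h.ract_reverse_mul hc hb m) j.1
  have h2 := h.wact_root_eq hc h1
  rw [wact_append, Module.End.mul_apply] at h2
  rw [← h2, ← Module.End.mul_apply (wact (gram K) m), (h.isCoxeterGram hc).wact_mul_reverse]
  rfl

end IsFaceSystem
end HypPoly

namespace HypPoly
open Filter Topology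

/-! ### Adjacent tiles -/

lemma spanDim_eq_three_mono {A B : Set H3} {e : Fin 4 → ℝ} (he : lor e e = 1) (hAB : A ⊆ B)
    (hB : B ⊆ plane e) (hA : spanDim A = 3) : spanDim B = 3 := by
  apply le_antisymm
  · rw [← finrank_ker_lorL he]
    apply Submodule.finrank_mono
    rw [Submodule.span_le]
    rintro _ ⟨x, hx, rfl⟩
    exact hB hx
  · rw [← hA]
    exact Submodule.finrank_mono (Submodule.span_mono (Set.image_mono hAB))

lemma eventually_nrm_notMem {T : Set H3} {K : Finset (Fin 4 → ℝ)} (h : IsFaceSystem T K)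
    {w : Fin 4 → ℝ} (hw : IsFut w) (hwT : nrm w hw ∉ T) (y : Fin 4 → ℝ) :
    ∀ᶠ t : ℝ in 𝓝[>] 0, ∀ ht : IsFut (w + t • y), nrm _ ht ∉ T := by
  rw [h.nrm_mem] at hwT
  push Not at hwT
  obtain ⟨k, hk, hpos⟩ := hwT
  have := eventually_lor_neg (q := w) (e := -k) (by rw [lor_neg_right]; linarith) y
  filter_upwards [this] with t ht hf hmem
  rw [lor_neg_right] at ht
  linarith [(h.nrm_mem hf).1 hmem k hk]

lemma exists_mem_forall_notMem {S : Set (Submodule ℝ (Fin 4 → ℝ))} (hS : S.Finite)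
    (E : Submodule ℝ (Fin 4 → ℝ)) (hE : ∀ W ∈ S, ¬ E ≤ W) : ∃ v ∈ E, ∀ W ∈ S, v ∉ W := by
  classical
  have := Subspace.biUnion_ne_univ_of_top_notMem
    (s := (hS.toFinset.image fun W => W.comap E.subtype)) (by
      intro hmem
      obtain ⟨W, hW, hWt⟩ := Finset.mem_image.1 hmem
      exact hE W (hS.mem_toFinset.1 hW) (Submodule.comap_subtype_eq_top.1 hWt))
  obtain ⟨v, hv⟩ := (Set.ne_univ_iff_exists_notMem _).1 this
  refine ⟨v.1, v.2, fun W hW hvW => hv ?_⟩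
  simp only [Set.mem_iUnion]
  exact ⟨_, Finset.mem_image_of_mem _ (hS.mem_toFinset.2 hW), hvW⟩

lemma eventually_add_smul_notMem {W : Submodule ℝ (Fin 4 → ℝ)} (q : Fin 4 → ℝ) {v : Fin 4 → ℝ}
    (hv : v ∉ W) : ∀ᶠ t : ℝ in 𝓝[>] 0, q + t • v ∉ W := by
  have hsub : {t : ℝ | q + t • v ∈ W}.Subsingleton := by
    intro s hs t ht
    by_contra hst
    apply hv
    have h1 : (s - t) • v ∈ W := by
      have := W.sub_mem hs ht
      rwa [add_sub_add_left_eq_sub, ← sub_smul] at this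
    have := W.smul_mem (s - t)⁻¹ h1
    rwa [smul_smul, inv_mul_cancel₀ (sub_ne_zero.2 hst), one_smul] at this
  have : ∀ᶠ t : ℝ in cofinite, q + t • v ∉ W := by
    rw [Filter.eventually_cofinite]; simpa using hsub.finite
  exact this.filter_mono ((nhdsGT_le_nhdsNE 0).trans (nhdsNE_le_cofinite 0))

variable {P : Set H3} {tiles : Set (Set H3)}

lemma isFaceNormal_of_subset {T : Set H3} (hTP : T ⊆ P) {e : Fin 4 → ℝ} (he : IsFaceNormal T e)
    (hPe : P ⊆ halfSpace e) : IsFaceNormal P e :=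
  ⟨he.1, hPe, spanDim_eq_three_mono he.1 (Set.inter_subset_inter_left _ hTP)
    Set.inter_subset_right he.2.2⟩

/-- Here `d` is interior to the face `e` of `T`. A point of `T'` on the same side of `plane e` as
`T` could be made interior to `T'`, and a small step from `d` towards it would enter both interiors.
-/
lemma subset_halfSpace_neg {T T' : Set H3} {K K' : Finset (Fin 4 → ℝ)} (hT : IsFaceSystem T K)
    (hT' : IsFaceSystem T' K') (hdisj : Disjoint (interior T) (interior T')) {e d : Fin 4 → ℝ}
    (hd : IsFut d) (hde : lor d e = 0) (hdK : ∀ l ∈ K, l ≠ e → lor d l < 0)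
    (hdT' : nrm d hd ∈ T') : T' ⊆ halfSpace (-e) := by
  intro y hy
  change lor y.1 (-e) ≤ 0
  rw [lor_neg_right, neg_nonpos]
  by_contra! hneg
  obtain ⟨z, hz⟩ := hT'.nonempty
  obtain ⟨s, hs, hs0⟩ := ((eventually_lor_neg hneg z.1).and self_mem_nhdsWithin).exists
  have hs0 : 0 < s := hs0
  set m := y.1 + s • z.1
  have hm : IsFut m := (isFut_coe y).add ((isFut_coe z).smul hs0)
  have hmK' : ∀ k ∈ K', lor m k < 0 := by
    intro k hk
    rw [lor_add_left, lor_smul_left]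
    nlinarith [hT'.mem.1 hy k hk, mul_neg_of_pos_of_neg hs0 (hT'.lor_neg hk hz)]
  have hev : ∀ᶠ t : ℝ in 𝓝[>] 0, ∀ l ∈ K, l ≠ e → lor (d + t • m) l < 0 := by
    rw [Filter.eventually_all_finset]
    intro l hl
    by_cases hle : l = e
    · simp [hle]
    · exact (eventually_lor_neg (hdK l hl hle) m).mono fun t ht _ => ht
  obtain ⟨t, ht, ht0⟩ := (hev.and self_mem_nhdsWithin).exists
  have ht0 : 0 < t := ht0
  have hx : IsFut (d + t • m) := hd.add (hm.smul ht0)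
  have hint : ∀ {e}, lor (d + t • m) e < 0 → lor (nrm _ hx).1 e < 0 := fun {e} h => by
    rw [nrm_coe, lor_smul_left]; exact mul_neg_of_pos_of_neg (inv_sqrt_pos hx) h
  refine Set.disjoint_left.1 hdisj (hT.mem_interior (x := nrm _ hx) fun l hl => hint ?_)
    (hT'.mem_interior fun k hk => hint ?_)
  · by_cases hle : l = e
    · rw [hle, lor_add_left, lor_smul_left, hde, zero_add]
      exact mul_neg_of_pos_of_neg ht0 hs
    · exact ht l hl hle
  · rw [lor_add_left, lor_smul_left]
    nlinarith [(hT'.nrm_mem hd).1 hdT' k hk, mul_neg_of_pos_of_neg ht0 (hmK' k hk)]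

lemma IsCoxeterDecomposition.subset (hD : IsCoxeterDecomposition P tiles) {T : Set H3}
    (hT : T ∈ tiles) : T ⊆ P := by
  rw [← hD.cover]; exact Set.subset_sUnion_of_mem hT

/-- Across a face of a tile that does not lie in a face of `P` there is another tile. -/
lemma IsCoxeterDecomposition.exists_adjacent (hD : IsCoxeterDecomposition P tiles)
    (hP : IsPolyhedron P) {T : Set H3} (hT : T ∈ tiles) {e : Fin 4 → ℝ} (he : IsFaceNormal T e)
    (hPe : ¬ IsFaceNormal P e) :
    ∃ T' ∈ tiles, T ≠ T' ∧ IsFaceNormal T' (-e) ∧ spanDim (T ∩ T' ∩ plane e) = 3 := by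
  obtain ⟨K, hK⟩ := (hD.coxeter T hT).1.exists_faceSystem
  obtain ⟨KP, hKP⟩ := hP.exists_faceSystem
  obtain ⟨q, hq, hqe, hqK⟩ := hK.relint e ((hK.mem_iff e).2 he)
  have hTP := hD.subset hT
  obtain ⟨y, hyP, hye⟩ : ∃ y ∈ P, 0 < lor y.1 e := by
    by_contra! hcon
    exact hPe (isFaceNormal_of_subset hTP he hcon)
  set S := {T' ∈ tiles | ∃ p ∈ T', 0 < lor p.1 e} with hS
  have hSfin : S.Finite := hD.finite.subset (Set.sep_subset _ _)
  -- Moving slightly from `w` towards `y` stays in `P` and crosses the plane; the finitely many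
  -- tiles that miss `w` also miss all nearby points.
  have hcover : ∀ w (hw : IsFut w), nrm w hw ∈ T → lor w e = 0 → ∃ T' ∈ S, nrm w hw ∈ T' := by
    intro w hw hwT hwe
    by_contra! hcon
    have hev : ∀ᶠ t : ℝ in 𝓝[>] 0, ∀ T' ∈ S, ∀ ht : IsFut (w + t • y.1), nrm _ ht ∉ T' := by
      rw [Filter.eventually_all_finite hSfin]
      intro T' hT'
      obtain ⟨K', hK'⟩ := (hD.coxeter T' hT'.1).1.exists_faceSystem
      exact eventually_nrm_notMem hK' hw (hcon T' hT') y.1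
    obtain ⟨t, ht, ht0⟩ := (hev.and self_mem_nhdsWithin).exists
    have ht0 : 0 < t := ht0
    have hf : IsFut (w + t • y.1) := hw.add ((isFut_coe y).smul ht0)
    have hmem : nrm _ hf ∈ P := by
      rw [hKP.nrm_mem]
      intro k hk
      have h1 := (hKP.nrm_mem hw).1 (hTP hwT) k hk
      have h2 := mul_nonpos_of_nonneg_of_nonpos ht0.le (hKP.mem.1 hyP k hk)
      rw [lor_add_left, lor_smul_left]
      linarith
    rw [← hD.cover] at hmem
    obtain ⟨T', hT', hmem'⟩ := hmem
    refine ht T' ⟨hT', _, hmem', ?_⟩ hf hmem'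
    have hpos : 0 < lor (w + t • y.1) e := by
      rw [lor_add_left, lor_smul_left, hwe, zero_add]; exact mul_pos ht0 hye
    rw [nrm_coe, lor_smul_left]
    exact mul_pos (inv_sqrt_pos hf) hpos
  set sp : Set H3 → Submodule ℝ (Fin 4 → ℝ) := fun T' =>
    Submodule.span ℝ (Subtype.val '' (T ∩ T' ∩ plane e)) with hsp
  -- A generic direction in the plane avoids the spans of all lower-dimensional contacts, so any
  -- tile beyond the plane that contains the displaced point shares a two-dimensional piece of the
  -- face.
  obtain ⟨v, hve, hv⟩ := exists_mem_forall_notMem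
    (S := {W ∈ sp '' S | ¬ LinearMap.ker (lorL e) ≤ W})
    ((hSfin.image sp).subset (Set.sep_subset _ _)) (LinearMap.ker (lorL e)) fun W hW => hW.2
  change lor v e = 0 at hve
  have hev1 : ∀ᶠ t : ℝ in 𝓝[>] 0, ∀ T' ∈ S, ¬ LinearMap.ker (lorL e) ≤ sp T' →
      q + t • v ∉ sp T' := by
    rw [Filter.eventually_all_finite hSfin]
    intro T' hT'
    by_cases hle : LinearMap.ker (lorL e) ≤ sp T'
    · simp [hle]
    · exact (eventually_add_smul_notMem q (hv _ ⟨⟨T', hT', rfl⟩, hle⟩)).mono fun t ht _ => ht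
  have hev2 : ∀ᶠ t : ℝ in 𝓝[>] 0, ∀ l ∈ K, l ≠ e → lor (q + t • v) l < 0 := by
    rw [Filter.eventually_all_finset]
    intro l hl
    by_cases hle : l = e
    · simp [hle]
    · exact (eventually_lor_neg (hqK l hl hle) v).mono fun t ht _ => ht
  obtain ⟨t, ⟨ht1, ht2⟩, hd⟩ := ((hev1.and hev2).and (hq.eventually v)).exists
  set d := q + t • v
  have hde : lor d e = 0 := by rw [lor_add_left, lor_smul_left, hqe, hve]; simp
  have hdT : nrm d hd ∈ T := by
    rw [hK.nrm_mem]
    intro l hl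
    by_cases hle : l = e
    · rw [hle, hde]
    · exact (ht2 l hl hle).le
  obtain ⟨T', hT', hdT'⟩ := hcover d hd hdT hde
  have hspan : LinearMap.ker (lorL e) ≤ sp T' := by
    by_contra hle
    apply ht1 T' hT' hle
    rw [eq_smul_nrm d hd]
    exact Submodule.smul_mem _ _ (Submodule.subset_span
      ⟨_, ⟨⟨hdT, hdT'⟩, (nrm_mem_plane hd).2 hde⟩, rfl⟩)
  have hdim : spanDim (T ∩ T' ∩ plane e) = 3 := by
    have heq : sp T' = LinearMap.ker (lorL e) := by
      refine le_antisymm ?_ hspan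
      rw [Submodule.span_le]
      rintro _ ⟨x, hx, rfl⟩
      exact hx.2
    change Module.finrank ℝ (sp T') = 3
    rw [heq, finrank_ker_lorL he.1]
  have hne : T ≠ T' := by
    rintro rfl
    obtain ⟨p, hp, hpos⟩ := hT'.2
    exact (he.2.1 hp).not_gt hpos
  obtain ⟨K', hK'⟩ := (hD.coxeter T' hT'.1).1.exists_faceSystem
  have hplane : plane (-e) = plane e := by
    ext x
    change lor x.1 (-e) = 0 ↔ lor x.1 e = 0
    rw [lor_neg_right, neg_eq_zero]
  refine ⟨T', hT'.1, hne, ⟨by simp [lor_neg_left, lor_neg_right, he.1],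
    subset_halfSpace_neg hK hK' (hD.disjoint_interior T hT T' hT'.1 hne) hd hde ht2 hdT', ?_⟩, hdim⟩
  rw [hplane]
  exact spanDim_eq_three_mono he.1 (Set.inter_subset_inter_left _ Set.inter_subset_right)
    Set.inter_subset_right hdim

end HypPoly

/-! ### Counting the faces of a tile -/

namespace HypPoly
open Filter Topology

namespace IsFaceSystem
variable {P F : Set H3} {tiles : Set (Set H3)} {K KP : Finset (Fin 4 → ℝ)}

lemma ract_injective [DecidableEq K] (h : IsFaceSystem F K) (hc : IsCoxeter F) (hb : IsBdd F)
    (l : List K) : Function.Injective (ract l) := fun x y hxy => by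
  have := congrArg (ract l.reverse) hxy
  rwa [← Module.End.mul_apply, ← Module.End.mul_apply, h.ract_reverse_mul hc hb] at this

/-- The image of `F` under the word `l` is the tile `T`. -/
def Reaches (F : Set H3) (T : Set H3) (l : List K) : Prop :=
  Subtype.val '' T = ract l '' (Subtype.val '' F)

lemma Reaches.isFaceNormal [DecidableEq K] (h : IsFaceSystem F K) (hc : IsCoxeter F)
    (hb : IsBdd F) {T : Set H3} {l : List K} (hl : Reaches F T l) (i : K) :
    IsFaceNormal T (ract l i.1) := by
  have hmem : ∀ x, x ∈ T ↔ ∃ y ∈ F, ract l y.1 = x.1 := fun x => by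
    have : x ∈ T ↔ x.1 ∈ Subtype.val '' T :=
      Subtype.val_injective.mem_set_image.symm
    rw [this, hl]
    simp only [Set.mem_image, exists_exists_and_eq_and]
  refine ⟨by rw [h.lor_ract, h.unit i.2], fun x hx => ?_, ?_⟩
  · obtain ⟨y, hy, hyx⟩ := (hmem x).1 hx
    change lor x.1 _ ≤ 0
    rw [← hyx, h.lor_ract]
    exact h.mem.1 hy i.1 i.2
  · have hi := ((h.mem_iff i.1).1 i.2).2.2
    have himg : Subtype.val '' (T ∩ plane (ract l i.1)) =
        ract l '' (Subtype.val '' (F ∩ plane i.1)) := by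
      ext w
      constructor
      · rintro ⟨x, ⟨hx, hxp⟩, rfl⟩
        obtain ⟨y, hy, hyx⟩ := (hmem x).1 hx
        refine ⟨y.1, ⟨y, ⟨hy, ?_⟩, rfl⟩, hyx⟩
        change lor x.1 _ = 0 at hxp
        rwa [← hyx, h.lor_ract] at hxp
      · rintro ⟨_, ⟨y, ⟨hy, hyp⟩, rfl⟩, rfl⟩
        have : ract l y.1 ∈ Subtype.val '' T := by rw [hl]; exact ⟨y.1, ⟨y, hy, rfl⟩, rfl⟩
        obtain ⟨x, hx, hxy⟩ := this
        refine ⟨x, ⟨hx, ?_⟩, hxy⟩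
        change lor x.1 _ = 0
        rw [hxy, h.lor_ract]
        exact hyp
    rw [spanDim, himg, Submodule.span_image,
      (Submodule.equivMapOfInjective _ (h.ract_injective hc hb l) _).symm.finrank_eq]
    exact hi

/-- The reflection in the image under `l` of the wall `i` is the conjugate by `l` of the simple
reflection, so crossing that wall appends `i` on the right. -/
lemma reaches_concat (h : IsFaceSystem F K) {T T' : Set H3} {l : List K} (hl : Reaches F T l) {i : K}
    (hsymm : SymmetricWrt (ract l i.1) T T') : Reaches F T' (l ++ [i]) := by
  have key : ∀ x, reflect (ract l i.1) (ract l x) = ract (l ++ [i]) x := fun x => by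
    rw [ract_append, ract_singleton, Module.End.mul_apply, reflL_apply, reflect, reflect,
      h.lor_ract, map_sub, map_smul]
  rw [Reaches, hsymm, hl, ← Set.image_comp]
  congr 1
  exact funext key

/-- The key estimate: a functional vanishing on the roots of the faces of `P` vanishes. -/
lemma functional_eq_zero [DecidableEq K] (h : IsFaceSystem F K) (hc : IsCoxeter F) (hb : IsBdd F)
    (hP : IsPolyhedron P) (hD : IsCoxeterDecomposition P tiles) (hF : F ∈ tiles)
    (u : (K → ℝ) →ₗ[ℝ] ℝ)
    (hu : ∀ T ∈ tiles, ∀ (l : List K) i, Reaches F T l → IsFaceNormal P (ract l i.1) →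
      u (wact (gram K) l (root i)) = 0) : u = 0 := by
  obtain ⟨c, hcpos, hcneg⟩ := h.exists_pos_comb hb
  have hG := h.isCoxeterGram hc
  -- Elements are collected rather than words: each tile accounts for at most one, which makes `W`
  -- finite.
  set W := {g | ∃ l : List K, wact (gram K) l = g ∧ ∃ T ∈ tiles, Reaches F T l} with hW
  have hWfin : W.Finite := by
    refine Set.Finite.of_surjOn (s := {T ∈ tiles | ∃ l : List K, Reaches F T l})
      (fun T => Classical.epsilon fun g => ∃ l : List K, wact (gram K) l = g ∧ Reaches F T l)
      ?_ (hD.finite.subset (Set.sep_subset _ _))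
    rintro _ ⟨l, rfl, T, hT, hl⟩
    refine ⟨T, ⟨hT, l, hl⟩, ?_⟩
    obtain ⟨m, hm1, hm2⟩ := Classical.epsilon_spec
      (p := fun g => ∃ l : List K, wact (gram K) l = g ∧ Reaches F T l) ⟨_, l, rfl, hl⟩
    refine hm1.symm.trans ?_
    exact h.wact_eq_of_image_eq hc hb (hm2.symm.trans hl)
  have hWne : W.Nonempty := ⟨_, [], rfl, F, hF, by simp [Reaches, ract]⟩
  have hcross : ∀ (l : List K) (i : K), (∃ T ∈ tiles, Reaches F T l) →
      u (wact (gram K) l (root i)) = 0 ∨ ∃ T ∈ tiles, Reaches F T (l ++ [i]) := by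
    rintro l i ⟨T, hT, hl⟩
    have hface := hl.isFaceNormal h hc hb i
    by_cases hPe : IsFaceNormal P (ract l i.1)
    · exact Or.inl (hu T hT l i hl hPe)
    · obtain ⟨T', hT', hne, hneg, hdim⟩ := hD.exists_adjacent hP hT hface hPe
      exact Or.inr ⟨T', hT', h.reaches_concat hl
        (hD.symm T hT T' hT' hne _ hface hneg hdim)⟩
  have hstep : ∀ (l : List K) (i : K), u (wact (gram K) (l ++ [i]) c) =
      u (wact (gram K) l c) - 2 * lor (comb K c) i.1 * u (wact (gram K) l (root i)) := by
    intro l i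
    rw [wact_append, Module.End.mul_apply, wact_singleton, srefl_apply, map_sub, map_smul, map_sub,
      map_smul, lor_comb_eq_pair, smul_eq_mul]
  have hexp : ∀ l : List K, u (wact (gram K) l c) = ∑ i, c i * u (wact (gram K) l (root i)) := by
    intro l
    have : c = ∑ i, c i • root i := by
      funext j; simp [root, Pi.single_apply]
    conv_lhs => rw [this]
    simp
  obtain ⟨_, ⟨l, rfl, hl⟩, hmax⟩ := Set.exists_max_image W (fun g => u (g c)) hWfin hWne
  obtain ⟨_, ⟨m, rfl, hm⟩, hmin⟩ := Set.exists_min_image W (fun g => u (g c)) hWfin hWne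
  -- By `hstep`, crossing adds `u (w αᵢ)` times the positive number `-2 * lor (comb K c) i`, and the
  -- value is already maximal.
  have hlneg : ∀ i, u (wact (gram K) l (root i)) ≤ 0 := by
    intro i
    rcases hcross l i hl with h0 | hT
    · exact h0.le
    · have h1 := hmax _ ⟨_, rfl, hT⟩
      simp only [hstep] at h1
      nlinarith [hcneg i.1 i.2]
  have hmpos : ∀ i, 0 ≤ u (wact (gram K) m (root i)) := by
    intro i
    rcases hcross m i hm with h0 | hT
    · exact h0.ge
    · have h1 := hmin _ ⟨_, rfl, hT⟩
      simp only [hstep] at h1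
      nlinarith [hcneg i.1 i.2]
  have hterm : ∀ i ∈ Finset.univ, c i * u (wact (gram K) l (root i)) ≤ 0 := fun i _ =>
    mul_nonpos_of_nonneg_of_nonpos (hcpos i).le (hlneg i)
  have hsum : ∑ i, c i * u (wact (gram K) l (root i)) = 0 := by
    apply le_antisymm (Finset.sum_nonpos hterm)
    rw [← hexp]
    have h1 : 0 ≤ u (wact (gram K) m c) := by
      rw [hexp]
      exact Finset.sum_nonneg fun i _ => mul_nonneg (hcpos i).le (hmpos i)
    exact h1.trans (hmax _ ⟨m, rfl, hm⟩)
  have hzero := (Finset.sum_eq_zero_iff_of_nonpos hterm).1 hsum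
  have hroot : ∀ i, u (wact (gram K) l (root i)) = 0 := fun i =>
    (mul_eq_zero.1 (hzero i (Finset.mem_univ i))).resolve_left (hcpos i).ne'
  have hcomp : u ∘ₗ wact (gram K) l = 0 := by
    refine LinearMap.pi_ext' fun i => LinearMap.ext_ring ?_
    simpa [root] using hroot i
  refine LinearMap.ext fun v => ?_
  have := LinearMap.congr_fun hcomp (wact (gram K) l.reverse v)
  rwa [LinearMap.comp_apply, ← Module.End.mul_apply, hG.wact_mul_reverse] at this

/-- Evaluation at the roots attached to the faces of `P` embeds the dual of `K → ℝ` into `KP → ℝ`.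
-/
lemma card_le [DecidableEq K] (h : IsFaceSystem F K) (hc : IsCoxeter F) (hb : IsBdd F)
    (hP : IsPolyhedron P) (hKP : IsFaceSystem P KP) (hD : IsCoxeterDecomposition P tiles)
    (hF : F ∈ tiles) : K.card ≤ KP.card := by
  classical
  set Q : KP → (K → ℝ) → Prop := fun n v =>
    -- All vectors satisfying `Q n` coincide, so the choice is harmless; where none exists, the
    -- arbitrary value is never used.
    ∃ T ∈ tiles, ∃ (l : List K) (i : K), Reaches F T l ∧ ract l i.1 = n.1 ∧
      wact (gram K) l (root i) = v with hQ
  set β : KP → (K → ℝ) := fun n => Classical.epsilon (Q n) with hβ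
  let Φ : ((K → ℝ) →ₗ[ℝ] ℝ) →ₗ[ℝ] (KP → ℝ) :=
    LinearMap.pi fun n => LinearMap.applyₗ (β n)
  have hΦ : Function.Injective Φ := by
    rw [injective_iff_map_eq_zero]
    intro u hu
    refine h.functional_eq_zero hc hb hP hD hF u fun T hT l i hl hface => ?_
    have hn := (hKP.mem_iff _).2 hface
    obtain ⟨T', -, m, j, -, hmj, hv⟩ := Classical.epsilon_spec (p := Q ⟨_, hn⟩)
      ⟨_, T, hT, l, i, hl, rfl, rfl⟩
    have hu' : u (β ⟨_, hn⟩) = 0 := congrFun hu ⟨_, hn⟩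
    rw [hβ] at hu'
    simp only at hu'
    rwa [← hv, h.wact_root_eq_of_ract_eq hc hb hmj] at hu'
  have := LinearMap.finrank_le_finrank_of_injective hΦ
  simpa [Module.finrank_linearMap] using this

end IsFaceSystem
end HypPoly

namespace HypPoly
open Filter Topology

namespace IsFaceSystem
variable {F : Set H3} {K : Finset (Fin 4 → ℝ)}

/-! ### Combinatorial types of bounded polyhedra with at most five faces -/

/-- A vertex is a point of `F` determined by the faces through it. If `y` lies on all of these, `x -
t y` stays in the cone for small `t`, so a plane supporting `F` at `x` also contains `y`.
Conversely, the sum of the normals through `x` supports `F` at `x` alone. -/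
lemma isVertex_iff (h : IsFaceSystem F K) {x : H3} :
    IsVertex F x ↔ x ∈ F ∧ ∀ y ∈ F, (∀ k ∈ K, lor x.1 k = 0 → lor y.1 k = 0) → y = x := by
  constructor
  · rintro ⟨e, -, hF, hx⟩
    have hxm : x ∈ F ∩ plane e := by rw [hx]; rfl
    refine ⟨hxm.1, fun y hy hyx => ?_⟩
    have hye : lor y.1 e ≤ 0 := hF hy
    have hxe : lor x.1 e = 0 := hxm.2
    have hev : ∀ᶠ t : ℝ in 𝓝[>] 0, ∀ k ∈ K, lor (x.1 + t • -y.1) k ≤ 0 := by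
      rw [Filter.eventually_all_finset]
      intro k hk
      rcases (h.mem.1 hxm.1 k hk).lt_or_eq with hlt | h0
      · exact (eventually_lor_neg hlt _).mono fun t ht => ht.le
      · refine Filter.Eventually.of_forall fun t => ?_
        rw [lor_add_left, lor_smul_left, lor_neg_left, h0, hyx k hk h0]; simp
    obtain ⟨t, ⟨ht1, ht2⟩, ht3⟩ :=
      ((hev.and ((isFut_coe x).eventually (-y.1))).and self_mem_nhdsWithin).exists
    have ht3 : 0 < t := ht3
    have h1 := (nrm_mem_halfSpace ht2).1 (hF ((h.nrm_mem ht2).2 ht1))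
    rw [lor_add_left, lor_smul_left, lor_neg_left, hxe] at h1
    have h2 : lor y.1 e = 0 := by nlinarith
    have : y ∈ F ∩ plane e := ⟨hy, h2⟩
    rw [hx] at this
    exact this
  · rintro ⟨hxF, hx⟩
    set Z := K.filter fun k => lor x.1 k = 0 with hZ
    set s := ∑ k ∈ Z, k with hs
    have hxs : lor x.1 s = 0 := by
      rw [hs, lor_sum_right]
      exact Finset.sum_eq_zero fun k hk => (Finset.mem_filter.1 hk).2
    have hys : ∀ y ∈ F, lor y.1 s ≤ 0 := fun y hy => by
      rw [hs, lor_sum_right]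
      exact Finset.sum_nonpos fun k hk => h.mem.1 hy k (Finset.mem_filter.1 hk).1
    have hyx : ∀ y ∈ F, lor y.1 s = 0 → y = x := by
      intro y hy hy0
      rw [hs, lor_sum_right, Finset.sum_eq_zero_iff_of_nonpos
        fun k hk => h.mem.1 hy k (Finset.mem_filter.1 hk).1] at hy0
      exact hx y hy fun k hk hk0 => hy0 k (Finset.mem_filter.2 ⟨hk, hk0⟩)
    -- A zero sum would reduce `F` to a point, against its nonempty interior.
    have hs0 : s ≠ 0 := by
      intro hs0
      have hF : ∀ y ∈ F, y = x := fun y hy => hyx y hy (by rw [hs0, lor_zero_right])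
      obtain ⟨z, hz⟩ := h.nonempty
      have hzx := hF z (interior_subset hz)
      have hev : ∀ᶠ t : ℝ in 𝓝[>] 0, ∀ k ∈ K, lor (z.1 + t • Pi.single 1 1) k < 0 := by
        rw [Filter.eventually_all_finset]
        exact fun k hk => eventually_lor_neg (h.lor_neg hk hz) _
      obtain ⟨t, ⟨ht1, ht2⟩, ht3⟩ :=
        ((hev.and ((isFut_coe z).eventually _)).and self_mem_nhdsWithin).exists
      have ht3 : 0 < t := ht3
      obtain ⟨c, hc⟩ : ∃ c : ℝ, z.1 + t • Pi.single 1 1 = c • z.1 := by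
        have := hF _ ((h.nrm_mem ht2).2 fun k hk => (ht1 k hk).le)
        have he := eq_smul_nrm _ ht2
        rw [this, ← hzx] at he
        exact ⟨_, he⟩
      have hc0 := congrFun hc 0
      have hc1 := congrFun hc 1
      simp at hc0 hc1
      have : c = 1 := (mul_right_cancel₀ z.2.2.ne' (by rw [one_mul]; exact hc0)).symm
      rw [this] at hc1
      linarith
    have hss : 0 < lor s s := (isFut_coe x).lor_pos_of_perp hxs hs0
    have hr := Real.sqrt_pos.2 hss
    refine ⟨(√(lor s s))⁻¹ • s, ?_, fun y hy => ?_, ?_⟩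
    · rw [lor_smul_left, lor_smul_right]
      nth_rewrite 3 [← Real.mul_self_sqrt hss.le]
      field_simp
    · change lor y.1 (_ • s) ≤ 0
      rw [lor_smul_right]
      exact mul_nonpos_of_nonneg_of_nonpos (inv_pos.2 hr).le (hys y hy)
    · ext y
      have : y ∈ plane ((√(lor s s))⁻¹ • s) ↔ lor y.1 s = 0 := by
        change lor y.1 (_ • s) = 0 ↔ _
        rw [lor_smul_right, mul_eq_zero, or_iff_right (inv_pos.2 hr).ne']
      rw [Set.mem_inter_iff, this]
      refine ⟨fun hy => hyx y hy.1 hy.2, fun hy => ?_⟩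
      rw [Set.mem_singleton_iff.1 hy]
      exact ⟨hxF, hxs⟩

/-- Faces correspond to face normals. -/
noncomputable def faceEquiv (h : IsFaceSystem F K) : K ≃ {f : Set H3 // IsFace F f} :=
  Equiv.ofBijective (fun k => ⟨F ∩ plane k.1, k.1, (h.mem_iff k.1).1 k.2, rfl⟩) <| by
    constructor
    · intro k l hkl
      by_contra hne
      have heq : F ∩ plane k.1 = F ∩ plane l.1 := congrArg Subtype.val hkl
      obtain ⟨q, hq, hqk, hqK⟩ := h.relint k.1 k.2
      have hm : nrm q hq ∈ F ∩ plane k.1 := by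
        refine ⟨(h.nrm_mem hq).2 fun j hj => ?_, (nrm_mem_plane hq).2 hqk⟩
        by_cases hjk : j = k.1
        · rw [hjk, hqk]
        · exact (hqK j hj hjk).le
      rw [heq] at hm
      exact (hqK l.1 l.2 (fun hlk => hne (Subtype.ext hlk.symm))).ne ((nrm_mem_plane hq).1 hm.2)
    · rintro ⟨_, e, he, rfl⟩
      exact ⟨⟨e, (h.mem_iff e).2 he⟩, rfl⟩

/-- Reduces the combinatorial type to the extreme rays `v i` of the cone over `F`: `hray` says that
the faces through `v i` meet in its line only, and `hmin` that every nonzero vector of the cone lies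
only on faces that contain some `v i`. -/
lemma hasIncidence_of (h : IsFaceSystem F K) (hb : IsBdd F) {ι κ : Type} (I : ι → κ → Prop)
    (e : κ ≃ K) (v : ι → Fin 4 → ℝ) (hv : ∀ i, v i ≠ 0) (hneg : ∀ i k, lor (v i) (e k).1 ≤ 0)
    (hI : ∀ i k, lor (v i) (e k).1 = 0 ↔ I i k)
    (hray : ∀ i y, (∀ k, I i k → lor y (e k).1 = 0) → ∃ c : ℝ, y = c • v i)
    (hmin : ∀ y, y ≠ 0 → (∀ k, lor y (e k).1 ≤ 0) → ∃ i, ∀ k, lor y (e k).1 = 0 → I i k)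
    (hinj : ∀ i j, (∀ k, I i k ↔ I j k) → i = j) : HasIncidence F I := by
  have hall : ∀ {p : (Fin 4 → ℝ) → Prop}, (∀ k, p (e k).1) → ∀ k ∈ K, p k := fun {p} hp k hk => by
    simpa using hp (e.symm ⟨k, hk⟩)
  have hfut : ∀ i, IsFut (v i) := fun i =>
    h.isFut_of_cone hb (hall (p := fun k => lor (v i) k ≤ 0) (hneg i)) (hv i)
  have hnrm : ∀ i k, lor (nrm (v i) (hfut i)).1 (e k).1 = 0 ↔ I i k := fun i k => by
    rw [← hI i k]; exact nrm_mem_plane (hfut i)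
  have hvert : ∀ i, IsVertex F (nrm (v i) (hfut i)) := by
    intro i
    rw [h.isVertex_iff, h.nrm_mem]
    refine ⟨hall (p := fun k => lor (v i) k ≤ 0) (hneg i), fun y hy hyz => ?_⟩
    obtain ⟨c, hc⟩ := hray i y.1 fun k hk => hyz _ (e k).2 ((hnrm i k).2 hk)
    have hc0 : 0 < c := by
      have h1 := y.2.2
      rw [hc] at h1
      exact (pos_iff_pos_of_mul_pos (show 0 < c * v i 0 from h1)).2 (hfut i).2
    symm
    apply nrm_smul (hfut i) (inv_pos.2 hc0)
    rw [hc, smul_smul, inv_mul_cancel₀ hc0.ne', one_smul]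
  refine ⟨Equiv.ofBijective (fun i => ⟨_, hvert i⟩) ⟨fun i j hij => hinj i j fun k => ?_, ?_⟩,
    e.trans h.faceEquiv, fun i k => ?_⟩
  · have := congrArg Subtype.val hij
    simp only at this
    rw [← hnrm i k, ← hnrm j k, this]
  · rintro ⟨x, hx⟩
    obtain ⟨hxF, hxm⟩ := h.isVertex_iff.1 hx
    obtain ⟨i, hi⟩ := hmin x.1 (isFut_coe x).ne_zero fun k => h.mem.1 hxF _ (e k).2
    refine ⟨i, Subtype.ext (hxm _ (h.isVertex_iff.1 (hvert i)).1 ?_)⟩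
    exact hall (p := fun k => lor x.1 k = 0 → lor (nrm (v i) (hfut i)).1 k = 0)
      fun k hk => (hnrm i k).2 (hi k hk)
  · rw [← hnrm i k]
    change nrm (v i) (hfut i) ∈ F ∩ plane (e k).1 ↔ _
    exact ⟨fun hm => hm.2, fun hm => ⟨(h.isVertex_iff.1 (hvert i)).1, hm⟩⟩

/-- The vector of the values `-lor y k`. -/
def slack {κ : Type} (e : κ ≃ K) : (Fin 4 → ℝ) →ₗ[ℝ] (κ → ℝ) :=
  LinearMap.pi fun k => -lorL (e k).1

lemma slack_apply {κ : Type} (e : κ ≃ K) (y : Fin 4 → ℝ) (k : κ) :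
    slack e y k = -lor y (e k).1 := rfl

lemma slack_injective (h : IsFaceSystem F K) (hb : IsBdd F) {κ : Type} (e : κ ≃ K) :
    Function.Injective (slack e) := by
  rw [injective_iff_map_eq_zero]
  intro y hy
  refine h.eq_zero_of_perp hb fun k hk => ?_
  have := congrFun hy (e.symm ⟨k, hk⟩)
  simpa [slack_apply] using this

lemma four_le_card (h : IsFaceSystem F K) (hb : IsBdd F) : 4 ≤ K.card := by
  have := LinearMap.finrank_le_finrank_of_surjective (h.comb_surjective hb)
  simpa using this

/-- With four faces `slack` is an isomorphism, and the vertices are the preimages of the coordinate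
vectors. -/
lemma hasIncidence_tetrahedron (h : IsFaceSystem F K) (hb : IsBdd F) (hK : K.card = 4) :
    HasIncidence F (fun i k : Fin 4 => i ≠ k) := by
  set e : Fin 4 ≃ K := (K.equivFinOfCardEq hK).symm
  have hinj := h.slack_injective hb e
  have hsurj := LinearMap.surjective_of_injective hinj
  choose v hv using fun i : Fin 4 => hsurj (Pi.single i 1)
  have hvk : ∀ i k, lor (v i) (e k).1 = -(Pi.single i 1 : Fin 4 → ℝ) k := fun i k => by
    rw [← hv i, slack_apply, neg_neg]
  refine h.hasIncidence_of hb _ e v ?_ ?_ ?_ ?_ ?_ ?_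
  · intro i h0
    have := congrFun (hv i) i
    simp [h0] at this
  · intro i k
    rw [hvk, Pi.single_apply]; split_ifs <;> norm_num
  · intro i k
    rw [hvk, Pi.single_apply]
    by_cases hik : k = i
    · simp [hik]
    · simp [hik, Ne.symm hik]
  · intro i y hy
    refine ⟨slack e y i, hinj ?_⟩
    rw [map_smul, hv]
    funext k
    by_cases hik : i = k
    · simp [hik]
    · simp [slack_apply, hy k hik, Ne.symm hik]
  · intro y hy0 _
    by_contra! hcon
    apply hy0
    apply hinj
    funext i
    obtain ⟨k, hk, hik⟩ := hcon i
    rw [hik, slack_apply, hk, map_zero]; simp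
  · intro i j hij
    by_contra hne
    exact ((hij i).2 (Ne.symm hne)) rfl

end IsFaceSystem
end HypPoly

/-! ### Five faces: the linear relation among the normals -/

namespace HypPoly
open Filter Topology

namespace IsFaceSystem
variable {F : Set H3} {K : Finset (Fin 4 → ℝ)}

/-- Pair the relation with a relative interior point of the face `p`: if the other coefficients were
all nonpositive, they would vanish, and then `a p` as well. -/
lemma exists_ne_pos_of_comb_eq_zero (h : IsFaceSystem F K) {a : K → ℝ} (ha : a ≠ 0)
    (hcomb : comb K a = 0) (p : K) : ∃ k, k ≠ p ∧ 0 < a k := by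
  by_contra! hcon
  obtain ⟨q, -, hqp, hqK⟩ := h.relint p.1 p.2
  have hneg : ∀ k : K, k ≠ p → lor k.1 q < 0 := fun k hk => by
    rw [lor_comm]; exact hqK k.1 k.2 (Subtype.coe_injective.ne hk)
  have hsum : ∑ k, a k * lor k.1 q = 0 := by rw [← lor_comb, hcomb, lor_zero_left]
  have hterm : ∀ k ∈ Finset.univ, 0 ≤ a k * lor k.1 q := by
    intro k _
    by_cases hk : k = p
    · rw [hk, lor_comm, hqp, mul_zero]
    · exact mul_nonneg_of_nonpos_of_nonpos (hcon k hk) (hneg k hk).le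
  have h0 := (Finset.sum_eq_zero_iff_of_nonneg hterm).1 hsum
  have hk0 : ∀ k, k ≠ p → a k = 0 := fun k hk =>
    (mul_eq_zero.1 (h0 k (Finset.mem_univ k))).resolve_right (hneg k hk).ne
  have hp : a p • p.1 = 0 := by
    rw [comb_apply, Finset.sum_eq_single p (fun k _ hk => by rw [hk0 k hk, zero_smul])
      (by simp)] at hcomb
    exact hcomb
  have hp0 : a p = 0 := by
    have : lor (a p • p.1) p.1 = 0 := by rw [hp, lor_zero_left]
    rwa [lor_smul_left, h.unit p.2, mul_one] at this
  apply ha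
  funext k
  by_cases hk : k = p
  · rw [hk, hp0]; rfl
  · exact hk0 k hk

lemma two_le_card_pos (h : IsFaceSystem F K) {a : K → ℝ} (ha : a ≠ 0)
    (hcomb : comb K a = 0) : 2 ≤ Fintype.card {k // 0 < a k} := by
  obtain ⟨k₀, -⟩ := Function.ne_iff.1 ha
  obtain ⟨k₁, -, h1⟩ := h.exists_ne_pos_of_comb_eq_zero ha hcomb k₀
  obtain ⟨k₂, h21, h2⟩ := h.exists_ne_pos_of_comb_eq_zero ha hcomb k₁
  exact Fintype.one_lt_card_iff.2 ⟨⟨k₂, h2⟩, ⟨k₁, h1⟩, fun he => h21 (congrArg Subtype.val he)⟩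

lemma sum_mul_slack {κ : Type} [Fintype κ] (e : κ ≃ K) {a : K → ℝ} (hcomb : comb K a = 0)
    (y : Fin 4 → ℝ) : ∑ k, a (e k) * slack e y k = 0 := by
  have h1 : ∑ k, a k * lor k.1 y = 0 := by rw [← lor_comb, hcomb, lor_zero_left]
  rw [← Equiv.sum_comp e] at h1
  rw [← neg_zero, ← h1, ← Finset.sum_neg_distrib]
  exact Finset.sum_congr rfl fun k _ => by rw [slack_apply, lor_comm]; ring

/-- The range of `slack` is four-dimensional and lies in the hyperplane of `ℝ⁵` given by the
relation, hence fills it. -/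
lemma exists_slack_eq (h : IsFaceSystem F K) (hb : IsBdd F) (hK : K.card = 5) {κ : Type}
    [Fintype κ] (e : κ ≃ K) {a : K → ℝ} (ha : a ≠ 0) (hcomb : comb K a = 0) {t : κ → ℝ}
    (ht : ∑ k, a (e k) * t k = 0) : ∃ y, slack e y = t := by
  classical
  let f : (κ → ℝ) →ₗ[ℝ] ℝ := Fintype.linearCombination ℝ fun k => a (e k)
  have hf : ∀ t, f t = ∑ k, a (e k) * t k := fun t => by
    simp [f, Fintype.linearCombination_apply, mul_comm]
  have hle : LinearMap.range (slack e) ≤ LinearMap.ker f := by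
    rintro _ ⟨y, rfl⟩
    rw [LinearMap.mem_ker, hf, sum_mul_slack e hcomb]
  have hf0 : f ≠ 0 := by
    intro h0
    obtain ⟨k, hk⟩ := Function.ne_iff.1 ha
    have := hf (Pi.single (e.symm k) 1)
    rw [h0, Finset.sum_eq_single (e.symm k)
      (fun j _ hj => by simp [hj]) (by simp)] at this
    simp at this
    exact hk this.symm
  have h1 := Module.Dual.finrank_ker_add_one_of_ne_zero hf0
  have h2 := LinearMap.finrank_range_of_inj (h.slack_injective hb e)
  have h3 : Fintype.card κ = 5 := by rw [Fintype.card_congr e, Fintype.card_coe, hK]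
  rw [Module.finrank_fintype_fun_eq_card, h3] at h1
  rw [Module.finrank_fin_fun] at h2
  have heq := Submodule.eq_of_le_of_finrank_eq hle (by omega)
  have : t ∈ LinearMap.ker f := by rw [LinearMap.mem_ker, hf, ht]
  rw [← heq] at this
  exact this

/-- Excludes the quadrangular pyramid. A zero coefficient at `k₀` would give an apex `p` on the four
other planes. Splitting the relation into its positive and negative parts yields a nonzero vector
orthogonal to the timelike `p`, hence spacelike; but computed as the product of the two parts, its
square involves only products of distinct normals and is nonpositive. -/
lemma ne_zero_of_comb_eq_zero (h : IsFaceSystem F K) (hb : IsBdd F)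
    (hG : ∀ e ∈ K, ∀ f ∈ K, e ≠ f → lor e f ≤ 0) (hK : K.card = 5) {a : K → ℝ} (ha : a ≠ 0)
    (hcomb : comb K a = 0) (k₀ : K) : a k₀ ≠ 0 := by
  classical
  intro hk₀
  obtain ⟨p, hp⟩ := h.exists_slack_eq hb hK (Equiv.refl K) ha hcomb (t := Pi.single k₀ 1) (by
    rw [Finset.sum_eq_single k₀ (fun j _ hj => by simp [hj]) (by simp)]
    simp [hk₀])
  have hpk : ∀ k : K, lor p k.1 = -(Pi.single k₀ 1 : K → ℝ) k := fun k => by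
    rw [← hp, slack_apply, neg_neg]; rfl
  have hp0 : p ≠ 0 := by
    rintro rfl
    have := hpk k₀
    simp [lor_zero_left] at this
  have hfut : IsFut p := h.isFut_of_cone hb (fun k hk => by
    rw [hpk ⟨k, hk⟩, Pi.single_apply]; split_ifs <;> norm_num) hp0
  set b : K → ℝ := fun k => max (a k) 0 with hbdef
  set c : K → ℝ := fun k => max (-a k) 0 with hcdef
  have hbc : a = b - c := by
    funext k
    simp only [hbdef, hcdef, Pi.sub_apply]
    rcases le_total 0 (a k) with h0 | h0
    · rw [max_eq_left h0, max_eq_right (by linarith)]; ring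
    · rw [max_eq_right h0, max_eq_left (by linarith)]; ring
  have hv : comb K b = comb K c := by
    rw [hbc, map_sub] at hcomb; exact sub_eq_zero.1 hcomb
  have hpv : lor p (comb K b) = 0 := by
    rw [lor_comm, lor_comb]
    refine Finset.sum_eq_zero fun k _ => ?_
    rw [lor_comm, hpk]
    by_cases hk : k = k₀
    · simp [hk, hbdef, hk₀]
    · simp [hk]
  have hb0 : ∀ k, 0 ≤ b k := fun k => le_max_right _ _
  have hc0 : ∀ k, 0 ≤ c k := fun k => le_max_right _ _
  have hv0 : comb K b ≠ 0 := by
    intro h0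
    obtain ⟨k₁, -, h1⟩ := h.exists_ne_pos_of_comb_eq_zero ha hcomb k₀
    obtain ⟨z, hz⟩ := h.nonempty
    have : lor (comb K b) z.1 < 0 := by
      rw [lor_comb]
      refine Finset.sum_neg' (fun k _ => mul_nonpos_of_nonneg_of_nonpos (hb0 k) ?_)
        ⟨k₁, Finset.mem_univ _, mul_neg_of_pos_of_neg (lt_max_of_lt_left h1) ?_⟩
      · rw [lor_comm]; exact (h.lor_neg k.2 hz).le
      · rw [lor_comm]; exact h.lor_neg k₁.2 hz
    rw [h0, lor_zero_left] at this
    exact lt_irrefl _ this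
  have hvv : lor (comb K b) (comb K b) ≤ 0 := by
    nth_rewrite 2 [hv]
    rw [lor_comb]
    refine Finset.sum_nonpos fun k _ => ?_
    rw [lor_comm, lor_comb, Finset.mul_sum]
    refine Finset.sum_nonpos fun j _ => ?_
    by_cases hjk : j = k
    · have : b k * c j = 0 := by
        subst hjk
        simp only [hbdef, hcdef]
        rcases le_total 0 (a j) with h0 | h0
        · rw [max_eq_right (a := -a j) (by linarith), mul_zero]
        · rw [max_eq_right h0, zero_mul]
      rw [← mul_assoc, this, zero_mul]
    · rw [← mul_assoc]
      exact mul_nonpos_of_nonneg_of_nonpos (mul_nonneg (hb0 k) (hc0 j))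
        (hG j.1 j.2 k.1 k.2 (Subtype.coe_injective.ne hjk))
  exact (hfut.lor_pos_of_perp hpv hv0).not_ge hvv

/-- Both signs occur at least twice among five nonzero coefficients, so they split as three and two,
up to negating the relation. -/
lemma exists_equiv_signs (h : IsFaceSystem F K) (hb : IsBdd F)
    (hG : ∀ e ∈ K, ∀ f ∈ K, e ≠ f → lor e f ≤ 0) (hK : K.card = 5) :
    ∃ (a : K → ℝ) (e : Fin 3 ⊕ Fin 2 ≃ K), comb K a = 0 ∧ (∀ c, 0 < a (e (Sum.inl c))) ∧
      ∀ d, a (e (Sum.inr d)) < 0 := by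
  classical
  obtain ⟨a₀, hcomb₀, ha₀⟩ : ∃ a, comb K a = 0 ∧ a ≠ 0 := by
    by_contra! hcon
    have := LinearMap.finrank_le_finrank_of_injective
      ((injective_iff_map_eq_zero (comb K)).2 hcon)
    simp [hK] at this
  have hsplit : ∀ a : K → ℝ, a ≠ 0 → comb K a = 0 →
      Fintype.card {k // 0 < a k} + Fintype.card {k // ¬ 0 < a k} = 5 ∧
      2 ≤ Fintype.card {k // 0 < a k} ∧ 2 ≤ Fintype.card {k // ¬ 0 < a k} ∧
      Fintype.card {k // ¬ 0 < a k} = Fintype.card {k // 0 < (-a) k} := by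
    intro a ha hcomb
    have h1 : Fintype.card {k // ¬ 0 < a k} = Fintype.card {k // 0 < (-a) k} := by
      refine Fintype.card_congr (Equiv.subtypeEquivRight fun k => ?_)
      have := h.ne_zero_of_comb_eq_zero hb hG hK ha hcomb k
      rw [Pi.neg_apply, neg_pos, not_lt]
      exact ⟨fun hle => lt_of_le_of_ne hle this, le_of_lt⟩
    refine ⟨?_, h.two_le_card_pos ha hcomb, ?_, h1⟩
    · rw [← Fintype.card_sum, Fintype.card_congr (Equiv.sumCompl fun k => 0 < a k),
        Fintype.card_coe, hK]
    · rw [h1]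
      exact h.two_le_card_pos (neg_ne_zero.2 ha) (by rw [map_neg, hcomb, neg_zero])
  obtain ⟨a, ha, hcomb, h3, h2⟩ : ∃ a : K → ℝ, a ≠ 0 ∧ comb K a = 0 ∧
      Fintype.card {k // 0 < a k} = 3 ∧ Fintype.card {k // ¬ 0 < a k} = 2 := by
    have hn0 : -a₀ ≠ 0 := neg_ne_zero.2 ha₀
    have hn1 : comb K (-a₀) = 0 := by rw [map_neg, hcomb₀, neg_zero]
    obtain ⟨e1, e2, e3, e4⟩ := hsplit a₀ ha₀ hcomb₀
    obtain ⟨f1, f2, f3, f4⟩ := hsplit (-a₀) hn0 hn1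
    by_cases hc : Fintype.card {k // 0 < a₀ k} = 3
    · exact ⟨a₀, ha₀, hcomb₀, hc, by omega⟩
    · exact ⟨-a₀, hn0, hn1, by omega, by omega⟩
  refine ⟨a, (Equiv.sumCongr (Fintype.equivFinOfCardEq h3).symm
    (Fintype.equivFinOfCardEq h2).symm).trans (Equiv.sumCompl fun k => 0 < a k), hcomb,
    fun c => ?_, fun d => ?_⟩
  · exact ((Fintype.equivFinOfCardEq h3).symm c).2
  · refine lt_of_le_of_ne (not_lt.1 ((Fintype.equivFinOfCardEq h2).symm d).2) ?_
    exact h.ne_zero_of_comb_eq_zero hb hG hK ha hcomb _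

lemma hasIncidence_prism (h : IsFaceSystem F K) (hb : IsBdd F)
    (hG : ∀ e ∈ K, ∀ f ∈ K, e ≠ f → lor e f ≤ 0) (hK : K.card = 5) :
    HasIncidence F prismIncidence := by
  classical
  obtain ⟨a, e, hcomb, hpos, hneg⟩ := h.exists_equiv_signs hb hG hK
  have ha : a ≠ 0 := by
    rintro rfl; simpa using hpos 0
  have hinj := h.slack_injective hb e
  -- The vertex `(c, d)` lies off exactly the side `c` and the base other than `d`; inverse
  -- coefficients as slacks make the two terms of the relation cancel.
  set t : Fin 3 × Fin 2 → Fin 3 ⊕ Fin 2 → ℝ := fun i => Sum.elim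
    (fun c => if i.1 = c then (a (e (Sum.inl c)))⁻¹ else 0)
    (fun d => if i.2 = d then 0 else -(a (e (Sum.inr d)))⁻¹) with ht
  have htsum : ∀ i, ∑ k, a (e k) * t i k = 0 := by
    rintro ⟨c, d⟩
    have h1 : ∑ c', a (e (Sum.inl c')) * t (c, d) (Sum.inl c') = 1 := by
      rw [Finset.sum_eq_single c (fun j _ hj => by simp [ht, hj.symm]) (by simp)]
      simp [ht, (hpos c).ne']
    have h2 : ∑ d', a (e (Sum.inr d')) * t (c, d) (Sum.inr d') = -1 := by
      have hd0 := (hneg 0).ne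
      have hd1 := (hneg 1).ne
      fin_cases d <;> simp [ht, hd0, hd1]
    rw [Fintype.sum_sum_type, h1, h2]; norm_num
  choose v hv using fun i => h.exists_slack_eq hb hK e ha hcomb (htsum i)
  have hvk : ∀ i k, lor (v i) (e k).1 = -t i k := fun i k => by
    rw [← hv i, slack_apply, neg_neg]
  refine h.hasIncidence_of hb _ e v ?_ ?_ ?_ ?_ ?_ ?_
  · intro i h0
    have := hvk i (Sum.inl i.1)
    simp [h0, lor_zero_left, ht, (hpos i.1).ne'] at this
  · rintro i (c | d) <;> rw [hvk, neg_nonpos]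
    · simp only [ht, Sum.elim_inl]
      split_ifs
      · exact (inv_pos.2 (hpos c)).le
      · exact le_rfl
    · simp only [ht, Sum.elim_inr]
      split_ifs
      · exact le_rfl
      · exact neg_nonneg.2 (inv_neg''.2 (hneg d)).le
  · rintro i (c | d) <;> rw [hvk, neg_eq_zero]
    · simp [ht, prismIncidence, (hpos c).ne']
    · simp [ht, prismIncidence, (hneg d).ne]
  · rintro ⟨c, d⟩ y hy
    refine ⟨slack e y (Sum.inl c) * a (e (Sum.inl c)), hinj ?_⟩
    rw [map_smul, hv]
    have hsum := sum_mul_slack e hcomb y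
    have hc : ∀ c', c ≠ c' → slack e y (Sum.inl c') = 0 := fun c' hcc' => by
      rw [slack_apply, hy (Sum.inl c') hcc', neg_zero]
    have hd : slack e y (Sum.inr d) = 0 := by
      rw [slack_apply, hy (Sum.inr d) rfl, neg_zero]
    rw [Fintype.sum_sum_type, Finset.sum_eq_single c
      (fun j _ hj => by rw [hc j hj.symm, mul_zero]) (by simp)] at hsum
    have hd' : ∀ d', d ≠ d' → a (e (Sum.inl c)) * slack e y (Sum.inl c) +
        a (e (Sum.inr d')) * slack e y (Sum.inr d') = 0 := by
      intro d' hdd'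
      rw [← hsum]
      congr 1
      symm
      refine Finset.sum_eq_single d' (fun j _ hj => ?_) (by simp)
      have : j = d := by omega
      rw [this, hd, mul_zero]
    funext k
    rcases k with c' | d'
    · by_cases hcc' : c = c'
      · subst hcc'
        simp [ht, (hpos c).ne']
      · simp [ht, hcc', hc c' hcc']
    · by_cases hdd' : d = d'
      · subst hdd'
        simp [ht, hd]
      · have h1 := hd' d' hdd'
        have h2 := (hneg d').ne
        simp only [ht, Pi.smul_apply, Sum.elim_inr, if_neg hdd', smul_eq_mul]
        field_simp
        linarith
  · intro y hy0 hyK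
    have hs : ∀ k, 0 ≤ slack e y k := fun k => by rw [slack_apply]; linarith [hyK k]
    have hsum := sum_mul_slack e hcomb y
    rw [Fintype.sum_sum_type] at hsum
    have hA : ∀ c ∈ Finset.univ, 0 ≤ a (e (Sum.inl c)) * slack e y (Sum.inl c) := fun c _ =>
      mul_nonneg (hpos c).le (hs _)
    have hB : ∀ d ∈ Finset.univ, a (e (Sum.inr d)) * slack e y (Sum.inr d) ≤ 0 := fun d _ =>
      mul_nonpos_of_nonpos_of_nonneg (hneg d).le (hs _)
    have hAB : (∑ c, a (e (Sum.inl c)) * slack e y (Sum.inl c)) ≠ 0 := by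
      intro h0
      rw [h0, zero_add] at hsum
      have h1 := (Finset.sum_eq_zero_iff_of_nonneg hA).1 h0
      have h2 := (Finset.sum_eq_zero_iff_of_nonpos hB).1 hsum
      apply hy0
      apply hinj
      rw [map_zero]
      funext k
      rcases k with c | d
      · exact (mul_eq_zero.1 (h1 c (Finset.mem_univ c))).resolve_left (hpos c).ne'
      · exact (mul_eq_zero.1 (h2 d (Finset.mem_univ d))).resolve_left (hneg d).ne
    obtain ⟨c, -, hc⟩ := Finset.exists_ne_zero_of_sum_ne_zero hAB
    have hB0 : (∑ d, a (e (Sum.inr d)) * slack e y (Sum.inr d)) ≠ 0 := fun h0 =>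
      hAB (by rwa [h0, add_zero] at hsum)
    obtain ⟨d, -, hd⟩ := Finset.exists_ne_zero_of_sum_ne_zero hB0
    -- Here `y` lies off the side `c` and the base `d`, and this is the vertex that lies off those
    -- two faces only.
    refine ⟨(c, 1 - d), ?_⟩
    rintro (c' | d') hk
    · change c ≠ c'
      rintro rfl
      exact hc (by rw [slack_apply, hk]; simp)
    · change 1 - d = d'
      have : d' ≠ d := by
        rintro rfl
        exact hd (by rw [slack_apply, hk]; simp)
      omega
  · rintro ⟨c, d⟩ ⟨c', d'⟩ hij
    have h1 : c = c' := by
      by_contra hne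
      exact ((hij (Sum.inl c')).1 hne) rfl
    have h2 : d' = d := (hij (Sum.inr d)).1 rfl
    rw [h1, h2]

lemma card_eq_of_hasIncidence (h : IsFaceSystem F K) {ι κ : Type} [Fintype κ] {I : ι → κ → Prop}
    (hI : HasIncidence F I) : K.card = Fintype.card κ := by
  obtain ⟨-, f, -⟩ := hI
  rw [← Fintype.card_coe, Fintype.card_congr (h.faceEquiv.trans f.symm)]

end IsFaceSystem
end HypPoly

theorem mainTheorem4 (P : Set HypPoly.H3) (hP : HypPoly.IsBddTriangularPrism P)
    (tiles : Set (Set HypPoly.H3)) (hD : HypPoly.IsCoxeterDecomposition P tiles)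
    (F : Set HypPoly.H3) (hF : F ∈ tiles) :
    HypPoly.IsBddTetrahedron F ∨ HypPoly.IsBddTriangularPrism F := by
  classical
  have hc := hD.coxeter F hF
  have hsub := hD.subset hF
  have hb : HypPoly.IsBdd F := by
    obtain ⟨R, hR⟩ := hP.2.1
    exact ⟨R, fun x hx y hy => hR x (hsub hx) y (hsub hy)⟩
  obtain ⟨K, hK⟩ := hc.1.exists_faceSystem
  obtain ⟨KP, hKP⟩ := hP.1.exists_faceSystem
  have h5 := hKP.card_eq_of_hasIncidence hP.2.2
  have hle := hK.card_le hc hb hP.1 hKP hD hF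
  have h4 := hK.four_le_card hb
  have hcard : Fintype.card (Fin 3 ⊕ Fin 2) = 5 := rfl
  rcases (by omega : K.card = 4 ∨ K.card = 5) with hk | hk
  · exact Or.inl ⟨hc.1, hb, hK.hasIncidence_tetrahedron hb hk⟩
  · exact Or.inr ⟨hc.1, hb, hK.hasIncidence_prism hb
      (fun e he f hf hef => hK.lor_nonpos hc he hf hef) hk⟩
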